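/- Let $\mathcal B$ be a Krull-Schmidt exact category with enough projectives and enough injectives (every object is a finite direct sum of objects with local endomorphism rings; short exact sequences of the exact structure are written $X\rightarrowtail Y\twoheadrightarrow Z$). A cotorsion pair $(\mathcal U,\mathcal V)$ on $\mathcal B$ is a pair of full additive subcategories closed under direct summands such that $\operatorname{Ext}^1_{\mathcal B}(\mathcal U,\mathcal V)=0$ and every object $B$ admits short exact sequences $V_B\rightarrowtail U_B\twoheadrightarrow B$ and $B\rightarrowtail V^B\twoheadrightarrow U^B$ with $U_B,U^B\in\mathcal U$ and $V_B,V^B\in\mathcal V$. Let $(\mathcal S,\mathcal T),(\mathcal U,\mathcal V)$ be a twin cotorsion pair on $\mathcal B$, i.e. two cotorsion pairs with $\mathcal S\subseteq\mathcal U$. Put $\mathcal W=\mathcal T\cap\mathcal U$; let $\mathcal B^+$ be the class of objects $B$ admitting a short exact sequence $V\rightarrowtail W\twoheadrightarrow B$ with $V\in\mathcal V$, $W\in\mathcal W$; let $\mathcal B^-$ be the class of objects $B$ admitting a short exact sequence $B\rightarrowtail W\twoheadrightarrow S$ with $W\in\mathcal W$, $S\in\mathcal S$; put $\mathcal H=\mathcal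 B^+\cap\mathcal B^-$. The heart is the quotient category $\underline{\mathcal H}=\mathcal H/\mathcal W$ of $\mathcal H$ by the ideal of morphisms that factor through an object of $\mathcal W$. An object of $\underline{\mathcal H}$ is projective (injective) if it has the lifting (extension) property for all epimorphisms (monomorphisms) of $\underline{\mathcal H}$. The heart has enough projectives (injectives) if for every object $X$ there is a morphism $P\to X$ that is a cokernel of some morphism, with $P$ projective (a morphism $X\to I$ that is a kernel of some morphism, with $I$ injective). Let $\Omega\mathcal S$ be the class of objects $X$ admitting a short exact sequence $X\rightarrowtail P\twoheadrightarrow S$ with $P$ projective in $\mathcal B$ and $S\in\mathcal S$, and $\Omega^-\mathcal V$ the class of objects $X$ admitting a short exact sequence $V\rightarrowtail I\twoheadrightarrow X$ with $I$ injective in $\mathcal B$ and $V\in\mathcal V$. (1) Assume $\mathcal U\subseteq\mathcal T$. Then $\Omega\mathcal S\subseteq\mathcal H$, and an object of $\underline{\mathcal H}$ is projective if and only if it is isomorphic in $\underline{\mathcal H}$ to an object of $\Omega\mathcal S$. Moreover $\underline{\mathcal H}$ has enough projectives if and only if every indecomposable object $B\in\mathcal H$ with $B\notin\mathcal U$ admits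 a short exact sequence $B\rightarrowtail S^1\twoheadrightarrow S^2$ with $S^1,S^2\in\mathcal S$. (2) Assume $\mathcal T\subseteq\mathcal U$. Then $\Omega^-\mathcal V\subseteq\mathcal H$, and an object of $\underline{\mathcal H}$ is injective if and only if it is isomorphic in $\underline{\mathcal H}$ to an object of $\Omega^-\mathcal V$. Moreover $\underline{\mathcal H}$ has enough injectives if and only if every indecomposable object $B\in\mathcal H$ with $B\notin\mathcal T$ admits a short exact sequence $V_2\rightarrowtail V_1\twoheadrightarrow B$ with $V_1,V_2\in\mathcal V$. -/

import Mathlib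

open CategoryTheory CategoryTheory.Limits

attribute [local instance] hasBinaryBiproducts_of_finite_biproducts

/-- The componentwise direct sum of two composable pairs `X ⟶ Y ⟶ Z` with zero composite. -/
noncomputable def shortComplexSum {C : Type*} [Category* C] [Preadditive C]
    [HasFiniteBiproducts C] (S S' : ShortComplex C) : ShortComplex C :=
  ShortComplex.mk (biprod.map S.f S'.f) (biprod.map S.g S'.g) (by ext <;> simp)

/-- A (Quillen) exact structure on an additive category `C`: a class of kernel-cokernel pairs
`X ↣ Y ↠ Z` (the short exact sequences, or conflations), stable under isomorphisms, direct sums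
and direct summands, such that identities are inflations and deflations, inflations (deflations)
compose, deflations can be pulled back and inflations can be pushed out along any morphism. -/
structure ExactStructure (C : Type*) [Category* C] [Preadditive C] [HasFiniteBiproducts C] where
  /-- the class of short exact sequences -/
  conflation : ObjectProperty (ShortComplex C)
  isKernel : ∀ S : ShortComplex C, conflation S → Nonempty (IsLimit (KernelFork.ofι S.f S.zero))
  isCokernel : ∀ S : ShortComplex C, conflation S →
    Nonempty (IsColimit (CokernelCofork.ofπ S.g S.zero))
  of_iso : ∀ S S' : ShortComplex C, Nonempty (S ≅ S') → conflation S → conflation S'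
  sum : ∀ S S' : ShortComplex C, conflation S → conflation S' → conflation (shortComplexSum S S')
  summand : ∀ S S' : ShortComplex C, conflation (shortComplexSum S S') → conflation S
  id_inflation : ∀ X : C, ∃ (Z : C) (d : X ⟶ Z) (w : 𝟙 X ≫ d = 0),
    conflation (ShortComplex.mk (𝟙 X) d w)
  id_deflation : ∀ X : C, ∃ (Z : C) (i : Z ⟶ X) (w : i ≫ 𝟙 X = 0),
    conflation (ShortComplex.mk i (𝟙 X) w)
  comp_inflation : ∀ {X Y Z : C} (i : X ⟶ Y) (j : Y ⟶ Z),
    (∃ (Q : C) (d : Y ⟶ Q) (w : i ≫ d = 0), conflation (ShortComplex.mk i d w)) →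
    (∃ (Q : C) (d : Z ⟶ Q) (w : j ≫ d = 0), conflation (ShortComplex.mk j d w)) →
    ∃ (Q : C) (d : Z ⟶ Q) (w : (i ≫ j) ≫ d = 0), conflation (ShortComplex.mk (i ≫ j) d w)
  comp_deflation : ∀ {X Y Z : C} (d : X ⟶ Y) (e : Y ⟶ Z),
    (∃ (K : C) (i : K ⟶ X) (w : i ≫ d = 0), conflation (ShortComplex.mk i d w)) →
    (∃ (K : C) (i : K ⟶ Y) (w : i ≫ e = 0), conflation (ShortComplex.mk i e w)) →
    ∃ (K : C) (i : K ⟶ X) (w : i ≫ d ≫ e = 0), conflation (ShortComplex.mk i (d ≫ e) w)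
  pullback_deflation : ∀ (S : ShortComplex C), conflation S → ∀ {Z' : C} (f : Z' ⟶ S.X₃),
    ∃ (Y' : C) (f' : Y' ⟶ S.X₂) (d' : Y' ⟶ Z'), IsPullback f' d' S.g f ∧
      ∃ (K : C) (i : K ⟶ Y') (w : i ≫ d' = 0), conflation (ShortComplex.mk i d' w)
  pushout_inflation : ∀ (S : ShortComplex C), conflation S → ∀ {X' : C} (g : S.X₁ ⟶ X'),
    ∃ (Y' : C) (g' : S.X₂ ⟶ Y') (i' : X' ⟶ Y'), IsPushout S.f g g' i' ∧
      ∃ (Q : C) (d : Y' ⟶ Q) (w : i' ≫ d = 0), conflation (ShortComplex.mk i' d w)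

/-- A Krull-Schmidt category: every object is a finite direct sum of objects with local
endomorphism rings. -/
def IsKrullSchmidt (C : Type*) [Category* C] [Preadditive C] [HasFiniteBiproducts C] : Prop :=
  ∀ X : C, ∃ (n : ℕ) (F : Fin n → C), (∀ i, IsLocalRing (End (F i))) ∧ Nonempty (X ≅ ⨁ F)

/-- Two morphisms are identified modulo `W` if their difference factors through an object
of `W`. -/
def factorRel {D : Type*} [Category* D] [Preadditive D] (W : ObjectProperty D) : HomRel D :=
  fun X Y f g => ∃ (Z : D) (a : X ⟶ Z) (b : Z ⟶ Y), W Z ∧ a ≫ b = f - g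

/-- The quotient category `D / W`. -/
abbrev IdealQuotient {D : Type*} [Category* D] [Preadditive D] (W : ObjectProperty D) : Type _ :=
  Quotient (factorRel W)

noncomputable instance IdealQuotient.hasZeroMorphisms {D : Type*} [Category* D] [Preadditive D]
    (W : ObjectProperty D) : HasZeroMorphisms (IdealQuotient W) where
  zero X Y := ⟨(Quotient.functor (factorRel W)).map (0 : X.as ⟶ Y.as)⟩
  comp_zero := by
    rintro X Y ⟨f⟩ Z
    change (Quotient.functor (factorRel W)).map f ≫
      (Quotient.functor (factorRel W)).map (0 : Y.as ⟶ Z.as) =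
        (Quotient.functor (factorRel W)).map (0 : X.as ⟶ Z.as)
    rw [← Functor.map_comp, comp_zero]
  zero_comp := by
    rintro X Y Z ⟨f⟩
    change (Quotient.functor (factorRel W)).map (0 : X.as ⟶ Y.as) ≫
      (Quotient.functor (factorRel W)).map f =
        (Quotient.functor (factorRel W)).map (0 : X.as ⟶ Z.as)
    rw [← Functor.map_comp, zero_comp]

/-- Every object `X` admits a morphism `P ⟶ X` which is a cokernel of some morphism, with `P`
projective (with respect to all epimorphisms). -/
def HasEnoughProjectivesByCokernels (D : Type*) [Category* D] [HasZeroMorphisms D] : Prop :=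
  ∀ X : D, ∃ (P : D) (δ : P ⟶ X), Projective P ∧ Nonempty (NormalEpi δ)

/-- Every object `X` admits a morphism `X ⟶ I` which is a kernel of some morphism, with `I`
injective (with respect to all monomorphisms). -/
def HasEnoughInjectivesByKernels (D : Type*) [Category* D] [HasZeroMorphisms D] : Prop :=
  ∀ X : D, ∃ (I : D) (δ : X ⟶ I), Injective I ∧ Nonempty (NormalMono δ)

/-- A full additive subcategory closed under direct summands (hence under isomorphisms). -/
structure IsAdditiveSummandClosed {C : Type*} [Category* C] [Preadditive C]
    [HasFiniteBiproducts C] (P : ObjectProperty C) : Prop where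
  zero : P.ContainsZero
  sum : ∀ X Y : C, P X → P Y → P (X ⊞ Y)
  summand : ∀ X Y Z : C, Nonempty (Z ≅ X ⊞ Y) → P Z → P X

namespace ExactStructure

variable {C : Type*} [Category* C] [Preadditive C] [HasFiniteBiproducts C] (E : ExactStructure C)

/-- `i : X ⟶ Y` and `d : Y ⟶ Z` form a short exact sequence `X ↣ Y ↠ Z`. -/
def IsConflation {X Y Z : C} (i : X ⟶ Y) (d : Y ⟶ Z) : Prop :=
  ∃ w : i ≫ d = 0, E.conflation (ShortComplex.mk i d w)

/-- `i` is the first map of a short exact sequence. -/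
def IsInflation {X Y : C} (i : X ⟶ Y) : Prop :=
  ∃ (Z : C) (d : Y ⟶ Z), E.IsConflation i d

/-- `d` is the second map of a short exact sequence. -/
def IsDeflation {Y Z : C} (d : Y ⟶ Z) : Prop :=
  ∃ (X : C) (i : X ⟶ Y), E.IsConflation i d

/-- Projective objects of the exact category. -/
def IsProj : ObjectProperty C := fun P =>
  ∀ ⦃X Y : C⦄ (f : X ⟶ Y), E.IsDeflation f → ∀ g : P ⟶ Y, ∃ h : P ⟶ X, h ≫ f = g

/-- Injective objects of the exact category. -/
def IsInj : ObjectProperty C := fun I =>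
  ∀ ⦃X Y : C⦄ (f : X ⟶ Y), E.IsInflation f → ∀ g : X ⟶ I, ∃ h : Y ⟶ I, f ≫ h = g

/-- The exact category has enough projectives. -/
def HasEnoughProj : Prop :=
  ∀ X : C, ∃ (P : C) (p : P ⟶ X), E.IsProj P ∧ E.IsDeflation p

/-- The exact category has enough injectives. -/
def HasEnoughInj : Prop :=
  ∀ X : C, ∃ (I : C) (j : X ⟶ I), E.IsInj I ∧ E.IsInflation j

/-- `Ext¹(A, B) = 0`: every short exact sequence `B ↣ Y ↠ A` splits. -/
def ExtOneVanishes (A B : C) : Prop :=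
  ∀ ⦃Y : C⦄ (i : B ⟶ Y) (d : Y ⟶ A) (w : i ≫ d = 0),
    E.conflation (ShortComplex.mk i d w) → Nonempty (ShortComplex.mk i d w).Splitting

/-- Cotorsion pairs `(U, V)`. -/
structure IsCotorsionPair (U V : ObjectProperty C) : Prop where
  left : IsAdditiveSummandClosed U
  right : IsAdditiveSummandClosed V
  ext_vanishes : ∀ A B : C, U A → V B → E.ExtOneVanishes A B
  resolution : ∀ B : C, ∃ (V' U' : C) (i : V' ⟶ U') (d : U' ⟶ B),
    V V' ∧ U U' ∧ E.IsConflation i d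
  coresolution : ∀ B : C, ∃ (V' U' : C) (i : B ⟶ V') (d : V' ⟶ U'),
    V V' ∧ U U' ∧ E.IsConflation i d

/-- Twin cotorsion pairs `(S, T), (U, V)`: two cotorsion pairs with `S ⊆ U`. -/
structure IsTwinCotorsionPair (S T U V : ObjectProperty C) : Prop where
  fst : E.IsCotorsionPair S T
  snd : E.IsCotorsionPair U V
  le : S ≤ U

/-- `C⁺`: objects `B` with a short exact sequence `V' ↣ W' ↠ B`, `V' ∈ V`, `W' ∈ T ∩ U`. -/
def plusPart (T U V : ObjectProperty C) : ObjectProperty C := fun B =>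
  ∃ (V' W' : C) (i : V' ⟶ W') (d : W' ⟶ B), V V' ∧ (T ⊓ U) W' ∧ E.IsConflation i d

/-- `C⁻`: objects `B` with a short exact sequence `B ↣ W' ↠ S'`, `W' ∈ T ∩ U`, `S' ∈ S`. -/
def minusPart (S T U : ObjectProperty C) : ObjectProperty C := fun B =>
  ∃ (W' S' : C) (i : B ⟶ W') (d : W' ⟶ S'), (T ⊓ U) W' ∧ S S' ∧ E.IsConflation i d

/-- `H = C⁺ ∩ C⁻`. -/
def heartObj (S T U V : ObjectProperty C) : ObjectProperty C :=
  E.plusPart T U V ⊓ E.minusPart S T U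

/-- The heart `H / W` of `(S, T), (U, V)`, where `W = T ∩ U`. -/
abbrev Heart (S T U V : ObjectProperty C) : Type _ :=
  IdealQuotient ((T ⊓ U).inverseImage (E.heartObj S T U V).ι)

/-- `Ω S`: objects `X` with a short exact sequence `X ↣ P ↠ S'`, `P` projective, `S' ∈ S`. -/
def syzygy (S : ObjectProperty C) : ObjectProperty C := fun X =>
  ∃ (P S' : C) (i : X ⟶ P) (d : P ⟶ S'), E.IsProj P ∧ S S' ∧ E.IsConflation i d

/-- `Ω⁻ V`: objects `X` with a short exact sequence `V' ↣ I ↠ X`, `I` injective, `V' ∈ V`. -/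
def cosyzygy (V : ObjectProperty C) : ObjectProperty C := fun X =>
  ∃ (V' I : C) (i : V' ⟶ I) (d : I ⟶ X), V V' ∧ E.IsInj I ∧ E.IsConflation i d

end ExactStructure

/-! Suppose `U ≤ T`. Then `T ⊓ U = U`, and the resolutions given by `(U, V)` put every object in the
plus part, so the heart consists of the objects `X` admitting `X ↣ U' ↠ S'`, taken modulo `U`
(`heartObj_eq_embedsInto`). Everything rests on `Ext¹(S, U) = 0`: a map that factors through `U`
extends along an inflation with cokernel in `S`, and the extension still factors through `U`
(`exists_extension_of_factorRel`). Consequently a cokernel in the heart of `f : A ⟶ B` is obtained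
by pushing `A ↣ U' ↠ S'` out along `f` (`cokernelMod_of_isPushout`), and when `f` is an epimorphism
there, the pushout object lies in `U`. This makes syzygies of `S` projective by a direct lifting
argument (`projMod_of_syzygy`).

Conversely, covering `U'` in `X ↣ U' ↠ S'` by a projective and pulling back gives a syzygy `Y` of
`S'` and a map `Y ⟶ X` that is an epimorphism in the heart, so a projective `X` is a retract of `Y`
modulo `U`. Krull-Schmidt turns retracts into isomorphisms: a local `X` outside `U` is already a
retract of the syzygy of one local summand of `S'`, and an idempotent on such a syzygy is trivial
modulo `U` because the endomorphism it induces on the local summand, or its complement, is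
invertible.

For enough projectives, a conflation `X ↣ S₁ ↠ S₂` covered in the same way presents `X` as the
cokernel of a map between syzygies (`exists_cokernelMod`). In the other direction, the pushout model
of a cokernel with syzygy target embeds into `S` with cokernel in `S`; a local object isomorphic to
it modulo `U` and not in `U` is an honest retract of it, and this class is closed under retracts.

The second half is the first one in the opposite category. Notions in the heart are formulated on
representatives modulo `factorRel` and carried over to the quotient category at the end. -/

namespace ExactStructure

variable {C : Type*} [Category* C] [Preadditive C] [HasFiniteBiproducts C] {E : ExactStructure C}

/-! ### Conflations: kernels, pushouts, pullbacks and splitting -/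

section Conflation

variable {X Y Z : C} {i : X ⟶ Y} {d : Y ⟶ Z}

lemma IsConflation.zero (h : E.IsConflation i d) : i ≫ d = 0 := h.1

lemma IsConflation.exists_lift (h : E.IsConflation i d) {A : C} (f : A ⟶ Y) (hf : f ≫ d = 0) :
    ∃ g : A ⟶ X, g ≫ i = f :=
  (E.isKernel _ h.2).elim fun hl =>
    ⟨hl.lift (KernelFork.ofι f hf), hl.fac (KernelFork.ofι f hf) WalkingParallelPair.zero⟩

lemma IsConflation.exists_desc (h : E.IsConflation i d) {A : C} (f : Y ⟶ A) (hf : i ≫ f = 0) :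
    ∃ g : Z ⟶ A, d ≫ g = f :=
  (E.isCokernel _ h.2).elim fun hl =>
    ⟨hl.desc (CokernelCofork.ofπ f hf), hl.fac (CokernelCofork.ofπ f hf) WalkingParallelPair.one⟩

lemma IsConflation.mono (h : E.IsConflation i d) : Mono i :=
  (E.isKernel _ h.2).elim fun hl => mono_of_isLimit_fork hl

lemma IsConflation.epi (h : E.IsConflation i d) : Epi d :=
  (E.isCokernel _ h.2).elim fun hl => epi_of_isColimit_cofork hl

lemma IsConflation.of_isos (h : E.IsConflation i d) {X' Z' : C} {i' : X' ⟶ Y} {d' : Y ⟶ Z'}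
    (e : X ≅ X') (e' : Z ≅ Z') (hi : e.hom ≫ i' = i) (hd : d ≫ e'.hom = d') :
    E.IsConflation i' d' := by
  have w : i' ≫ d' = 0 := by
    rw [← cancel_epi e.hom, reassoc_of% hi, ← hd, reassoc_of% h.zero]; simp
  refine ⟨w, E.of_iso _ _ ⟨?_⟩ h.2⟩
  exact ShortComplex.isoMk e (Iso.refl _) e' (by simpa using hi) (by simpa using hd.symm)

/-- A deflation together with any of its kernels is a conflation. -/
lemma IsDeflation.isConflation (hd : E.IsDeflation d) (w : i ≫ d = 0) [Mono i]
    (hl : ∀ ⦃A : C⦄ (f : A ⟶ Y), f ≫ d = 0 → ∃ g : A ⟶ X, g ≫ i = f) : E.IsConflation i d := by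
  obtain ⟨K, k, hk⟩ := hd
  have := hk.mono
  obtain ⟨a, ha⟩ := hl k hk.zero
  obtain ⟨b, hb⟩ := hk.exists_lift i w
  refine hk.of_isos ⟨a, b, ?_, ?_⟩ (Iso.refl _) ha (by simp)
  · rw [← cancel_mono k]; simp [hb, ha]
  · rw [← cancel_mono i]; simp [hb, ha]

/-- An inflation together with any of its cokernels is a conflation. -/
lemma IsInflation.isConflation (hi : E.IsInflation i) (w : i ≫ d = 0) [Epi d]
    (hl : ∀ ⦃A : C⦄ (f : Y ⟶ A), i ≫ f = 0 → ∃ g : Z ⟶ A, d ≫ g = f) : E.IsConflation i d := by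
  obtain ⟨K, k, hk⟩ := hi
  have := hk.epi
  obtain ⟨a, ha⟩ := hl k hk.zero
  obtain ⟨b, hb⟩ := hk.exists_desc d w
  refine hk.of_isos (Iso.refl _) ⟨b, a, ?_, ?_⟩ (by simp) hb
  · rw [← cancel_epi k]; simp [reassoc_of% hb, ha]
  · rw [← cancel_epi d]; simp [reassoc_of% ha, hb]

lemma IsConflation.exists_isPushout (h : E.IsConflation i d) {X' : C} (g : X ⟶ X') :
    ∃ (Y' : C) (g' : Y ⟶ Y') (i' : X' ⟶ Y'), IsPushout i g g' i' := by
  obtain ⟨Y', g', i', hp, -⟩ := E.pushout_inflation _ h.2 g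
  exact ⟨Y', g', i', hp⟩

lemma IsConflation.exists_isPullback (h : E.IsConflation i d) {Z' : C} (f : Z' ⟶ Z) :
    ∃ (Y' : C) (f' : Y' ⟶ Y) (d' : Y' ⟶ Z'), IsPullback f' d' d f := by
  obtain ⟨Y', g', i', hp, -⟩ := E.pullback_deflation _ h.2 f
  exact ⟨Y', g', i', hp⟩

/-- A pushout of a conflation along a morphism from its first term. -/
lemma IsConflation.pushout (h : E.IsConflation i d) {X' Y' : C} {g : X ⟶ X'} {g' : Y ⟶ Y'}
    {i' : X' ⟶ Y'} (hp : IsPushout i g g' i') :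
    ∃ d' : Y' ⟶ Z, g' ≫ d' = d ∧ E.IsConflation i' d' := by
  have hinf : E.IsInflation i' := by
    obtain ⟨Y'', g'', i'', hp', Q, q, hq⟩ := E.pushout_inflation _ h.2 g
    have hq : E.IsConflation i'' q := hq
    let e := hp'.isoIsPushout _ _ hp
    have he : i'' ≫ e.hom = i' := hp'.inr_isoIsPushout_hom _ _ hp
    have w : i' ≫ e.inv ≫ q = 0 := by rw [← he]; simp [hq.zero]
    refine ⟨Q, e.inv ≫ q, w, E.of_iso _ _ ⟨?_⟩ hq.2⟩
    exact ShortComplex.isoMk (Iso.refl _) e (Iso.refl _) (by simp [he]) (by simp)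
  refine ⟨hp.desc d 0 (by simp [h.zero]), by simp, ?_⟩
  have := h.epi
  have : Epi (hp.desc d 0 (by simp [h.zero])) :=
    epi_of_epi_fac (hp.inl_desc _ _ _)
  refine hinf.isConflation (by simp) fun A f hf => ?_
  obtain ⟨u, hu⟩ := h.exists_desc (g' ≫ f) (by rw [reassoc_of% hp.w, hf, comp_zero])
  exact ⟨u, hp.hom_ext (by simpa using hu) (by simp [hf])⟩

/-- A pullback of a conflation along a morphism to its last term. -/
lemma IsConflation.pullback (h : E.IsConflation i d) {Z' Y' : C} {f : Z' ⟶ Z} {f' : Y' ⟶ Y}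
    {d' : Y' ⟶ Z'} (hp : IsPullback f' d' d f) :
    ∃ i' : X ⟶ Y', i' ≫ f' = i ∧ E.IsConflation i' d' := by
  have hdef : E.IsDeflation d' := by
    obtain ⟨Y'', f'', d'', hp', Q, q, hq⟩ := E.pullback_deflation _ h.2 f
    have hq : E.IsConflation q d'' := hq
    let e := hp'.isoIsPullback _ _ hp
    have he : e.hom ≫ d' = d'' := hp'.isoIsPullback_hom_snd _ _ hp
    have w : (q ≫ e.hom) ≫ d' = 0 := by rw [Category.assoc, he, hq.zero]
    refine ⟨Q, q ≫ e.hom, w, E.of_iso _ _ ⟨?_⟩ hq.2⟩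
    exact ShortComplex.isoMk (Iso.refl _) e (Iso.refl _) (by simp) (by simp [he])
  refine ⟨hp.lift i 0 (by simp [h.zero]), by simp, ?_⟩
  have := h.mono
  have : Mono (hp.lift i 0 (by simp [h.zero])) :=
    mono_of_mono_fac (hp.lift_fst _ _ _)
  refine hdef.isConflation (by simp) fun A t ht => ?_
  obtain ⟨u, hu⟩ := h.exists_lift (t ≫ f') (by rw [Category.assoc, hp.w, reassoc_of% ht, zero_comp])
  exact ⟨u, hp.hom_ext (by simpa using hu) (by simp [ht])⟩

/-- A morphism `X ⟶ B` extends along the inflation `X ↣ Y` with cokernel `Z` if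
`Ext¹(Z, B) = 0`. -/
lemma IsConflation.exists_extension (h : E.IsConflation i d) {B : C} (hB : E.ExtOneVanishes Z B)
    (f : X ⟶ B) : ∃ g : Y ⟶ B, i ≫ g = f := by
  obtain ⟨Y', f', i', hp⟩ := h.exists_isPushout f
  obtain ⟨d', -, h'⟩ := h.pushout hp
  obtain ⟨s⟩ := hB i' d' h'.1 h'.2
  exact ⟨f' ≫ s.r, by have := s.f_r; dsimp at this; rw [reassoc_of% hp.w, this, Category.comp_id]⟩

/-- A morphism `A ⟶ Z` lifts along the deflation `Y ↠ Z` with kernel `X` if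
`Ext¹(A, X) = 0`. -/
lemma IsConflation.exists_factorization (h : E.IsConflation i d) {A : C}
    (hA : E.ExtOneVanishes A X) (f : A ⟶ Z) : ∃ g : A ⟶ Y, g ≫ d = f := by
  obtain ⟨Y', f', d', hp⟩ := h.exists_isPullback f
  obtain ⟨i', -, h'⟩ := h.pullback hp
  obtain ⟨s⟩ := hA i' d' h'.1 h'.2
  refine ⟨s.s ≫ f', ?_⟩
  have := s.s_g
  dsimp at this
  rw [Category.assoc, hp.w, reassoc_of% this]

lemma IsConflation.sum (h : E.IsConflation i d) {X' Y' Z' : C} {i' : X' ⟶ Y'} {d' : Y' ⟶ Z'}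
    (h' : E.IsConflation i' d') : E.IsConflation (biprod.map i i') (biprod.map d d') :=
  ⟨_, E.sum _ _ h.2 h'.2⟩

lemma IsConflation.nonempty_iso (h : E.IsConflation i d) (hZ : E.ExtOneVanishes Z X) :
    Nonempty (Y ≅ X ⊞ Z) :=
  (hZ i d h.1 h.2).map fun s => s.isoBinaryBiproduct

lemma IsConflation.splitting_of_section (h : E.IsConflation i d) (s : Z ⟶ Y) (hs : s ≫ d = 𝟙 Z) :
    Nonempty (ShortComplex.mk i d h.zero).Splitting := by
  have := h.mono
  obtain ⟨r, hr⟩ := h.exists_lift (𝟙 Y - d ≫ s) (by simp [hs])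
  exact ⟨{ r := r, s := s, s_g := hs, id := by simp [hr]
           f_r := by
            rw [← cancel_mono i]
            simp [hr, reassoc_of% h.zero] }⟩

end Conflation

variable (E)

lemma isConflation_id_zero (X : C) {Z : C} (hZ : IsZero Z) : E.IsConflation (𝟙 X) (0 : X ⟶ Z) := by
  have h : E.IsInflation (𝟙 X) := E.id_inflation X
  have : Epi (0 : X ⟶ Z) := ⟨fun _ _ _ => hZ.eq_of_src _ _⟩
  exact h.isConflation (by simp) fun A f hf => ⟨0, by simpa using hf.symm⟩

lemma isConflation_zero_id (X : C) {Z : C} (hZ : IsZero Z) : E.IsConflation (0 : Z ⟶ X) (𝟙 X) := by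
  have h : E.IsDeflation (𝟙 X) := E.id_deflation X
  have : Mono (0 : Z ⟶ X) := ⟨fun _ _ _ => hZ.eq_of_tgt _ _⟩
  exact h.isConflation (by simp) fun A f hf => ⟨0, by simpa using hf.symm⟩

end ExactStructure

/-! ### The ideal of morphisms factoring through a subcategory -/

section FactorRel

variable {D : Type*} [Category* D] [Preadditive D] {W : ObjectProperty D}

lemma factorRel_zero_iff {X Y : D} {f : X ⟶ Y} :
    factorRel W f 0 ↔ ∃ (Z : D) (a : X ⟶ Z) (b : Z ⟶ Y), W Z ∧ a ≫ b = f := by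
  simp only [factorRel, sub_zero]

lemma factorRel_iff_sub {X Y : D} {f g : X ⟶ Y} : factorRel W f g ↔ factorRel W (f - g) 0 := by
  simp only [factorRel, sub_zero]

lemma factorRel_of_mem {X Y Z : D} (hZ : W Z) (a : X ⟶ Z) (b : Z ⟶ Y) :
    factorRel W (a ≫ b) 0 := factorRel_zero_iff.2 ⟨Z, a, b, hZ, rfl⟩

lemma factorRel.comp_left {X Y Z : D} {f g : Y ⟶ Z} (h : factorRel W f g) (e : X ⟶ Y) :
    factorRel W (e ≫ f) (e ≫ g) := by
  obtain ⟨A, a, b, hA, hab⟩ := h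
  exact ⟨A, e ≫ a, b, hA, by rw [Category.assoc, hab, Preadditive.comp_sub]⟩

lemma factorRel.comp_right {X Y Z : D} {f g : X ⟶ Y} (h : factorRel W f g) (e : Y ⟶ Z) :
    factorRel W (f ≫ e) (g ≫ e) := by
  obtain ⟨A, a, b, hA, hab⟩ := h
  exact ⟨A, a, b ≫ e, hA, by rw [← Category.assoc, hab, Preadditive.sub_comp]⟩

lemma factorRel.symm {X Y : D} {f g : X ⟶ Y} (h : factorRel W f g) : factorRel W g f := by
  obtain ⟨A, a, b, hA, hab⟩ := h
  exact ⟨A, a, -b, hA, by rw [Preadditive.comp_neg, hab, neg_sub]⟩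

variable [HasFiniteBiproducts D]

/-- Two factorizations combine into one through the direct sum of their middle objects; closure
under sums is what makes the relation additive. -/
lemma factorRel.add (hW : IsAdditiveSummandClosed W) {X Y : D} {f g f' g' : X ⟶ Y}
    (h : factorRel W f g) (h' : factorRel W f' g') : factorRel W (f + f') (g + g') := by
  obtain ⟨A, a, b, hA, hab⟩ := h
  obtain ⟨A', a', b', hA', hab'⟩ := h'
  refine ⟨A ⊞ A', biprod.lift a a', biprod.desc b b', hW.sum _ _ hA hA', ?_⟩
  rw [biprod.lift_desc, hab, hab']
  abel

lemma factorRel.trans (hW : IsAdditiveSummandClosed W) {X Y : D} {f g h : X ⟶ Y}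
    (hfg : factorRel W f g) (hgh : factorRel W g h) : factorRel W f h := by
  rw [factorRel_iff_sub] at *
  simpa using hfg.add hW hgh

lemma factorRel_refl (hW : IsAdditiveSummandClosed W) {X Y : D} (f : X ⟶ Y) :
    factorRel W f f := by
  obtain ⟨Z, -, hZ⟩ := hW.zero.exists_zero
  exact ⟨Z, 0, 0, hZ, by simp⟩

lemma factorRel.sub (hW : IsAdditiveSummandClosed W) {X Y : D} {f g f' g' : X ⟶ Y}
    (h : factorRel W f g) (h' : factorRel W f' g') : factorRel W (f - f') (g - g') := by
  rw [factorRel_iff_sub] at *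
  have := h.add hW (h'.comp_right (-𝟙 Y))
  rw [Preadditive.comp_neg, Category.comp_id, zero_comp, add_zero] at this
  convert this using 1
  abel

lemma factorRel.biprod_map (hW : IsAdditiveSummandClosed W) {X Y X' Y' : D} {f g : X ⟶ Y}
    {f' g' : X' ⟶ Y'} (h : factorRel W f g) (h' : factorRel W f' g') :
    factorRel W (biprod.map f f') (biprod.map g g') := by
  have key : ∀ (u : X ⟶ Y) (v : X' ⟶ Y'),
      biprod.map u v = biprod.fst ≫ u ≫ biprod.inl + biprod.snd ≫ v ≫ biprod.inr := by
    intro u v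
    ext <;> simp
  rw [key, key]
  exact ((h.comp_right _).comp_left _).add hW ((h'.comp_right _).comp_left _)

end FactorRel

/-! ### Isomorphism modulo the ideal -/

section IsoMod

variable {D : Type*} [Category* D] [Preadditive D] (W : ObjectProperty D)

/-- Two objects which become isomorphic modulo the ideal of morphisms that factor through `W`. -/
def IsoMod (X Y : D) : Prop :=
  ∃ (f : X ⟶ Y) (g : Y ⟶ X), factorRel W (f ≫ g) (𝟙 X) ∧ factorRel W (g ≫ f) (𝟙 Y)

variable {W}

lemma IsoMod.symm {X Y : D} (h : IsoMod W X Y) : IsoMod W Y X := by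
  obtain ⟨f, g, h, h'⟩ := h
  exact ⟨g, f, h', h⟩

lemma isoMod_of_mem {X Y : D} (hX : W X) (hY : W Y) : IsoMod W X Y :=
  ⟨0, 0, (by simpa using (factorRel_of_mem hX (𝟙 X) (𝟙 X)).symm),
    (by simpa using (factorRel_of_mem hY (𝟙 Y) (𝟙 Y)).symm)⟩

variable [HasFiniteBiproducts D] (hW : IsAdditiveSummandClosed W)
include hW

lemma IsoMod.of_iso {X Y : D} (e : X ≅ Y) : IsoMod W X Y :=
  ⟨e.hom, e.inv, by simpa using factorRel_refl hW _, by simpa using factorRel_refl hW _⟩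

lemma IsoMod.trans {X Y Z : D} (h : IsoMod W X Y) (h' : IsoMod W Y Z) : IsoMod W X Z := by
  obtain ⟨f, g, h₁, h₂⟩ := h
  obtain ⟨f', g', h₁', h₂'⟩ := h'
  refine ⟨f ≫ f', g' ≫ g, ?_, ?_⟩
  · have := (h₁'.comp_left f).comp_right g
    simp only [Category.assoc, Category.comp_id] at this ⊢
    exact this.trans hW h₁
  · have := (h₂.comp_left g').comp_right f'
    simp only [Category.assoc, Category.comp_id] at this ⊢
    exact this.trans hW h₂'

lemma IsoMod.biprod {X Y X' Y' : D} (h : IsoMod W X Y) (h' : IsoMod W X' Y') :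
    IsoMod W (X ⊞ X') (Y ⊞ Y') := by
  obtain ⟨f, g, h₁, h₂⟩ := h
  obtain ⟨f', g', h₁', h₂'⟩ := h'
  have key : ∀ A B : D, biprod.map (𝟙 A) (𝟙 B) = 𝟙 (A ⊞ B) := fun A B => by ext <;> simp
  refine ⟨biprod.map f f', biprod.map g g', ?_, ?_⟩
  · have := h₁.biprod_map hW h₁'
    rwa [key, show biprod.map (f ≫ g) (f' ≫ g') = biprod.map f f' ≫ biprod.map g g' by
      ext <;> simp] at this
  · have := h₂.biprod_map hW h₂'
    rwa [key, show biprod.map (g ≫ f) (g' ≫ f') = biprod.map g g' ≫ biprod.map f f' by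
      ext <;> simp] at this

end IsoMod

/-! ### Local objects and Krull-Schmidt decompositions -/

section Local

variable {D : Type*} [Category* D] [Preadditive D]

/-- Objects with a local endomorphism ring. -/
def IsLocalObject (X : D) : Prop :=
  ¬ IsZero X ∧ ∀ f : X ⟶ X, IsIso f ∨ IsIso (𝟙 X - f)

lemma isLocalObject_of_isLocalRing (X : D) [IsLocalRing (End X)] : IsLocalObject X := by
  refine ⟨fun h => ?_, fun f => ?_⟩
  · exact one_ne_zero (α := End X) (h.eq_of_src _ _)
  · exact (IsLocalRing.isUnit_or_isUnit_of_add_one (R := End X) (a := f) (b := 𝟙 X - f)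
      (add_sub_cancel _ _)).imp (isUnit_iff_isIso f).1 (isUnit_iff_isIso _).1

lemma IsLocalObject.of_iso {X Y : D} (h : IsLocalObject X) (e : X ≅ Y) : IsLocalObject Y := by
  refine ⟨fun hY => h.1 (hY.of_iso e), fun f => ?_⟩
  have key : ∀ g : Y ⟶ Y, IsIso (e.hom ≫ g ≫ e.inv) → IsIso g := fun g hg => by
    have : g = e.inv ≫ (e.hom ≫ g ≫ e.inv) ≫ e.hom := by simp
    rw [this]
    infer_instance
  refine (h.2 (e.hom ≫ f ≫ e.inv)).imp (key _) fun h' => key _ ?_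
  simpa [Preadditive.sub_comp, Preadditive.comp_sub] using h'

variable [HasFiniteBiproducts D]

/-- Finite direct sums of objects with local endomorphism rings. -/
inductive IsSumOfLocals : D → Prop
  | zero (X : D) : IsZero X → IsSumOfLocals X
  | cons (X A B : D) : IsLocalObject A → IsSumOfLocals B → (X ≅ A ⊞ B) → IsSumOfLocals X

lemma IsSumOfLocals.of_iso {X Y : D} (h : IsSumOfLocals X) (e : Y ≅ X) : IsSumOfLocals Y := by
  cases h with
  | zero _ h => exact .zero _ (h.of_iso e)
  | cons _ A B hA hB e' => exact .cons _ A B hA hB (e ≪≫ e')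

/-- Splitting off the first summand. -/
noncomputable def biproductFinSucc {n : ℕ} (F : Fin (n + 1) → D) :
    ⨁ F ≅ F 0 ⊞ ⨁ (fun i : Fin n => F i.succ) where
  hom := biprod.lift (biproduct.π F 0) (biproduct.lift fun i => biproduct.π F i.succ)
  inv := biprod.desc (biproduct.ι F 0) (biproduct.desc fun i => biproduct.ι F i.succ)
  hom_inv_id := by
    rw [biprod.lift_desc, biproduct.lift_desc, ← biproduct.total, Fin.sum_univ_succ]
  inv_hom_id := by
    ext i j
    · simp
    · simp [biproduct.ι_π_ne F (Fin.succ_ne_zero _).symm]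
    · simp [biproduct.ι_π_ne F (Fin.succ_ne_zero _)]
    · by_cases h : i = j
      · subst h
        simp
      · simp [biproduct.ι_π_ne _ h, biproduct.ι_π_ne F (fun h' => h (Fin.succ_injective _ h'))]

lemma IsKrullSchmidt.isSumOfLocals (hD : IsKrullSchmidt D) (X : D) : IsSumOfLocals X := by
  obtain ⟨n, F, hF, ⟨e⟩⟩ := hD X
  refine IsSumOfLocals.of_iso ?_ e
  clear e
  induction n with
  | zero => exact .zero _ ((IsZero.iff_id_eq_zero _).2 (by ext i; exact i.elim0))
  | succ n ih =>
    have := hF 0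
    exact .cons _ _ _ (isLocalObject_of_isLocalRing (F 0)) (ih _ fun i => hF i.succ)
      (biproductFinSucc F)

lemma isZero_of_isIso_zero_left {A B : D} (h : IsIso (biprod.map (𝟙 A) (0 : B ⟶ B))) :
    IsZero B := by
  rw [IsZero.iff_id_eq_zero]
  have h0 : biprod.inr ≫ biprod.map (𝟙 A) (0 : B ⟶ B) = 0 := by simp
  have : (biprod.inr : B ⟶ A ⊞ B) = 0 := by rwa [← cancel_mono (biprod.map (𝟙 A) (0 : B ⟶ B)), zero_comp]
  rw [← biprod.inr_snd (X := A) (Y := B), this, zero_comp]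

lemma isZero_of_isIso_zero_right {A B : D} (h : IsIso (biprod.map (0 : A ⟶ A) (𝟙 B))) :
    IsZero A := by
  rw [IsZero.iff_id_eq_zero]
  have h0 : biprod.inl ≫ biprod.map (0 : A ⟶ A) (𝟙 B) = 0 := by simp
  have : (biprod.inl : A ⟶ A ⊞ B) = 0 := by rwa [← cancel_mono (biprod.map (0 : A ⟶ A) (𝟙 B)), zero_comp]
  rw [← biprod.inl_fst (X := A) (Y := B), this, zero_comp]

lemma IsLocalObject.indecomposable {X : D} (h : IsLocalObject X) : Indecomposable X := by
  refine ⟨h.1, fun Y Z e => ?_⟩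
  -- The projection onto `Y` or its complement is invertible, which kills the other summand.
  rcases (h.of_iso e).2 (biprod.map (𝟙 Y) 0) with h' | h'
  · exact Or.inr (isZero_of_isIso_zero_left h')
  · refine Or.inl (isZero_of_isIso_zero_right (B := Z) ?_)
    convert h' using 1
    ext <;> simp

lemma IsSumOfLocals.isLocalObject {X : D} (h : IsSumOfLocals X) (hX : Indecomposable X) :
    IsLocalObject X := by
  cases h with
  | zero _ h => exact (hX.1 h).elim
  | cons _ A B hA hB e =>
    rcases hX.2 A B e with h | h
    · exact (hA.1 h).elim
    · exact hA.of_iso (isoBiprodZero h ≪≫ e.symm)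

end Local

section

variable {C : Type*} [Category* C] [Preadditive C] [HasFiniteBiproducts C]

lemma IsAdditiveSummandClosed.of_iso {P : ObjectProperty C} (hP : IsAdditiveSummandClosed P)
    {X Y : C} (e : X ≅ Y) (h : P X) : P Y := by
  obtain ⟨Z, hZ, -⟩ := hP.zero.exists_zero
  exact hP.summand Y Z X ⟨e ≪≫ isoBiprodZero hZ⟩ h

lemma IsAdditiveSummandClosed.of_isZero {P : ObjectProperty C} (hP : IsAdditiveSummandClosed P)
    {X : C} (h : IsZero X) : P X := by
  obtain ⟨Z, hZ, hPZ⟩ := hP.zero.exists_zero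
  exact hP.of_iso (hZ.iso h) hPZ

end

/-! ### Closure properties of cotorsion pairs and of the objects of the heart -/

namespace ExactStructure

variable {C : Type*} [Category* C] [Preadditive C] [HasFiniteBiproducts C] (E : ExactStructure C)

/-- Objects `B` with a short exact sequence `B ↣ A' ↠ S'`, `A' ∈ A`, `S' ∈ S`. -/
def embedsInto (A S : ObjectProperty C) : ObjectProperty C := fun B =>
  ∃ (A' S' : C) (i : B ⟶ A') (d : A' ⟶ S'), A A' ∧ S S' ∧ E.IsConflation i d

variable {E} {S T U V : ObjectProperty C}

namespace IsCotorsionPair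

lemma mem_left_of_section (h : E.IsCotorsionPair U V) {K Y X : C} {i : K ⟶ Y} {d : Y ⟶ X}
    (hid : E.IsConflation i d) (hY : U Y) (s : X ⟶ Y) (hs : s ≫ d = 𝟙 X) : U X := by
  obtain ⟨σ⟩ := hid.splitting_of_section s hs
  exact h.left.summand X K Y ⟨σ.isoBinaryBiproduct ≪≫ biprod.braiding _ _⟩ hY

/-- Summand closure concerns direct sum decompositions only. A retract is reduced to it by lifting
the retraction to a resolution of `X`, whose deflation then splits. -/
lemma mem_left_of_retract (h : E.IsCotorsionPair U V) {X Y : C} (hY : U Y) (s : X ⟶ Y)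
    (r : Y ⟶ X) (hsr : s ≫ r = 𝟙 X) : U X := by
  obtain ⟨V', U', i, d, hV, hU, hid⟩ := h.resolution X
  obtain ⟨g, hg⟩ := hid.exists_factorization (h.ext_vanishes _ _ hY hV) r
  exact h.mem_left_of_section hid hU (s ≫ g) (by rw [Category.assoc, hg, hsr])

lemma mem_left_of_factorRel (h : E.IsCotorsionPair U V) {X : C}
    (hX : factorRel U (𝟙 X) 0) : U X := by
  obtain ⟨Y, a, b, hY, hab⟩ := factorRel_zero_iff.1 hX
  exact h.mem_left_of_retract hY a b hab

lemma mem_left_of_isProj (h : E.IsCotorsionPair U V) {P : C} (hP : E.IsProj P) : U P := by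
  obtain ⟨V', U', i, d, hV, hU, hid⟩ := h.resolution P
  obtain ⟨s, hs⟩ := hP d ⟨_, _, hid⟩ (𝟙 P)
  exact h.mem_left_of_section hid hU s hs

end IsCotorsionPair

/-- Push out `B ↣ D` and `B ↣ A₀` against each other. The conflation `A₀ ↣ Q ↠ S'` splits, so `Q`
lies in `A`, and `D ↣ Q` has the cokernel of `B ↣ A₀`. It is used both with `A = U` and with `A =
S`. -/
lemma embedsInto_of_conflation (hST : E.IsCotorsionPair S T) {A : ObjectProperty C}
    (hA : IsAdditiveSummandClosed A) (hSA : S ≤ A) (hAT : A ≤ T) {B D S' : C} {i : B ⟶ D}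
    {d : D ⟶ S'} (hid : E.IsConflation i d) (hS' : S S') (hB : E.embedsInto A S B) :
    E.embedsInto A S D := by
  obtain ⟨A₀, S₀, a, q, hA₀, hS₀, haq⟩ := hB
  obtain ⟨Q, x, y, hp⟩ := hid.exists_isPushout a
  obtain ⟨e, -, he⟩ := hid.pushout hp
  obtain ⟨e', -, he'⟩ := haq.pushout hp.flip
  obtain ⟨φ⟩ := he.nonempty_iso (hST.ext_vanishes _ _ hS' (hAT _ hA₀))
  exact ⟨Q, S₀, x, e', hA.of_iso φ.symm (hA.sum _ _ hA₀ (hSA _ hS')), hS₀, he'⟩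

/-- The coresolution `B ↣ T' ↠ S'` given by `(S, T)` already works: comparing it with `D ↣ A₀ ↠ S₀`
in both directions exhibits `T'` as a retract of `A₀ ⊞ S'`. -/
lemma embedsInto_of_retract (hST : E.IsCotorsionPair S T) {A R : ObjectProperty C}
    (hAR : E.IsCotorsionPair A R) (hSA : S ≤ A) (hAT : A ≤ T) {B D : C} (s : B ⟶ D) (r : D ⟶ B)
    (hsr : s ≫ r = 𝟙 B) (hD : E.embedsInto A S D) : E.embedsInto A S B := by
  obtain ⟨A₀, S₀, a, q, hA₀, hS₀, haq⟩ := hD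
  obtain ⟨T', S', i, d, hT', hS', hid⟩ := hST.coresolution B
  obtain ⟨u, hu⟩ := hid.exists_extension (hST.ext_vanishes _ _ hS' (hAT _ hA₀)) (s ≫ a)
  obtain ⟨v, hv⟩ := haq.exists_extension (hST.ext_vanishes _ _ hS₀ hT') (r ≫ i)
  -- The round trip `u ≫ v` is the identity on `B`, so its defect on `T'` factors through `S'`.
  obtain ⟨n, hn⟩ := hid.exists_desc (𝟙 T' - u ≫ v) (by
    rw [Preadditive.comp_sub, reassoc_of% hu, hv, reassoc_of% hsr]; simp)
  refine ⟨T', S', i, d, ?_, hS', hid⟩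
  refine hAR.mem_left_of_retract (hAR.left.sum _ _ hA₀ (hSA _ hS')) (biprod.lift u d)
    (biprod.desc v n) ?_
  rw [biprod.lift_desc, hn]
  abel

lemma embedsInto_sum {A : ObjectProperty C} (hA : IsAdditiveSummandClosed A)
    (hS : IsAdditiveSummandClosed S) {B B' : C} (hB : E.embedsInto A S B)
    (hB' : E.embedsInto A S B') : E.embedsInto A S (B ⊞ B') := by
  obtain ⟨A₀, S₀, a, q, hA₀, hS₀, haq⟩ := hB
  obtain ⟨A₀', S₀', a', q', hA₀', hS₀', haq'⟩ := hB'
  exact ⟨_, _, _, _, hA.sum _ _ hA₀ hA₀', hS.sum _ _ hS₀ hS₀', haq.sum haq'⟩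

lemma syzygy_sum (hS : IsAdditiveSummandClosed S) {B B' : C} (hB : E.syzygy S B)
    (hB' : E.syzygy S B') : E.syzygy S (B ⊞ B') := by
  obtain ⟨A₀, S₀, a, q, hA₀, hS₀, haq⟩ := hB
  obtain ⟨A₀', S₀', a', q', hA₀', hS₀', haq'⟩ := hB'
  refine ⟨_, _, _, _, fun X Y f hf g => ?_, hS.sum _ _ hS₀ hS₀', haq.sum haq'⟩
  obtain ⟨u, hu⟩ := hA₀ f hf (biprod.inl ≫ g)
  obtain ⟨v, hv⟩ := hA₀' f hf (biprod.inr ≫ g)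
  exact ⟨biprod.desc u v, by ext <;> simp [hu, hv]⟩

lemma syzygy_of_isZero (hS : IsAdditiveSummandClosed S) {X : C} (hX : IsZero X) :
    E.syzygy S X :=
  ⟨X, X, 𝟙 X, 0, fun _ _ _ _ _ => ⟨0, hX.eq_of_src _ _⟩, hS.of_isZero hX,
    E.isConflation_id_zero X hX⟩

end ExactStructure

/-! ### Epimorphisms, projectives and cokernels of the quotient, on representatives -/

section Predicates

variable {D : Type*} [Category* D] [Preadditive D] (H W : ObjectProperty D)

/-- `f` is an epimorphism in the quotient of the full subcategory `H` by `W`. -/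
def EpiMod {A B : D} (f : A ⟶ B) : Prop :=
  ∀ ⦃Z : D⦄, H Z → ∀ z : B ⟶ Z, factorRel W (f ≫ z) 0 → factorRel W z 0

/-- `X` is projective in the quotient of the full subcategory `H` by `W`. -/
def ProjMod (X : D) : Prop :=
  ∀ ⦃A B : D⦄, H A → H B → ∀ f : A ⟶ B, EpiMod H W f → ∀ g : X ⟶ B,
    ∃ t : X ⟶ A, factorRel W (t ≫ f) g

/-- `δ` is a cokernel of `φ` in the quotient of the full subcategory `H` by `W`. -/
def CokernelMod {A B X : D} (φ : A ⟶ B) (δ : B ⟶ X) : Prop :=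
  factorRel W (φ ≫ δ) 0 ∧ EpiMod H W δ ∧
    ∀ ⦃Z : D⦄, H Z → ∀ t : B ⟶ Z, factorRel W (φ ≫ t) 0 → ∃ t' : X ⟶ Z, factorRel W (δ ≫ t') t

/-- The quotient of the full subcategory `H` by `W` has enough projectives, by cokernels. -/
def EnoughProjMod : Prop :=
  ∀ X : D, H X → ∃ (A P : D) (φ : A ⟶ P) (δ : P ⟶ X), H A ∧ H P ∧ ProjMod H W P ∧
    CokernelMod H W φ δ

variable {H W}

lemma CokernelMod.isoMod [HasFiniteBiproducts D] (hW : IsAdditiveSummandClosed W) {A B X Y : D}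
    (hX : H X) (hY : H Y) {φ : A ⟶ B} {δ : B ⟶ X} {ε : B ⟶ Y} (h : CokernelMod H W φ δ)
    (h' : CokernelMod H W φ ε) : IsoMod W X Y := by
  have key : ∀ {X Y : D} (_ : H X) (_ : H Y) {δ : B ⟶ X} {ε : B ⟶ Y} (_ : CokernelMod H W φ δ)
      (f : X ⟶ Y) (g : Y ⟶ X), factorRel W (δ ≫ f) ε → factorRel W (ε ≫ g) δ →
      factorRel W (f ≫ g) (𝟙 X) := by
    intro X Y hX hY δ ε h f g hf hg
    rw [factorRel_iff_sub]
    refine h.2.1 hX _ ?_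
    rw [Preadditive.comp_sub, ← factorRel_iff_sub, Category.comp_id, ← Category.assoc]
    exact (hf.comp_right g).trans hW hg
  obtain ⟨f, hf⟩ := h.2.2 hY ε h'.1
  obtain ⟨g, hg⟩ := h'.2.2 hX δ h.1
  exact ⟨f, g, key hX hY h f g hf hg, key hY hX h' g f hg hf⟩

lemma CokernelMod.comp_isoMod [HasFiniteBiproducts D] (hW : IsAdditiveSummandClosed W)
    {A B X Y : D} {φ : A ⟶ B} {δ : B ⟶ X} (h : CokernelMod H W φ δ)
    {f : X ⟶ Y} {g : Y ⟶ X} (hfg : factorRel W (f ≫ g) (𝟙 X)) (hgf : factorRel W (g ≫ f) (𝟙 Y)) :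
    CokernelMod H W φ (δ ≫ f) := by
  refine ⟨?_, fun Z hZ z hz => ?_, fun Z hZ t ht => ?_⟩
  · simpa using h.1.comp_right f
  · have h1 := h.2.1 hZ (f ≫ z) (by simpa using hz)
    have h2 := (hgf.comp_right z).symm
    simp only [Category.id_comp, Category.assoc] at h2
    exact h2.trans hW (by simpa using h1.comp_left g)
  · obtain ⟨t', ht'⟩ := h.2.2 hZ t ht
    refine ⟨g ≫ t', ?_⟩
    have := (hfg.comp_right t').comp_left δ
    simp only [Category.id_comp, Category.assoc] at this ⊢
    exact this.trans hW ht'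

lemma ProjMod.of_isoMod [HasFiniteBiproducts D] (hW : IsAdditiveSummandClosed W) {X Y : D}
    (h : ProjMod H W X) (e : IsoMod W X Y) : ProjMod H W Y := by
  obtain ⟨f, g, -, hgf⟩ := e
  intro A B hA hB p hp q
  obtain ⟨t, ht⟩ := h hA hB p hp (f ≫ q)
  refine ⟨g ≫ t, ?_⟩
  have := hgf.comp_right q
  rw [Category.assoc, Category.id_comp] at this
  rw [Category.assoc]
  exact (ht.comp_left g).trans hW this

end Predicates

/-! ### Projectives and cokernels in the heart when `U ≤ T` -/

namespace ExactStructure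

variable {C : Type*} [Category* C] [Preadditive C] [HasFiniteBiproducts C] {E : ExactStructure C}
  {S T U V : ObjectProperty C}

/-- A conflation `X ↣ W' ↠ S'` is covered by conflations `K ↣ P ↠ W'` and `Y ↣ P ↠ S'`
with `P` projective, and the induced sequence `K ⟶ Y ⟶ X` is a conflation. -/
lemma IsConflation.exists_cover (hproj : E.HasEnoughProj) {X W' S' : C} {a : X ⟶ W'}
    {d : W' ⟶ S'} (h : E.IsConflation a d) :
    ∃ (P K Y : C) (k : K ⟶ Y) (j : Y ⟶ P) (y : Y ⟶ X) (r : P ⟶ W'), E.IsProj P ∧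
      E.IsConflation k y ∧ E.IsConflation j (r ≫ d) ∧ E.IsConflation (k ≫ j) r ∧
      j ≫ r = y ≫ a := by
  obtain ⟨P, r, hP, K, κ, hκ⟩ := hproj W'
  obtain ⟨Y, j, y, hp⟩ := hκ.exists_isPullback a
  obtain ⟨k, hk, hky⟩ := hκ.pullback hp
  refine ⟨P, K, Y, k, j, y, r, hP, hky, ?_, hk ▸ hκ, hp.w⟩
  have := h.mono
  have : Mono j := ⟨fun u v huv => hp.hom_ext huv (by
    rw [← cancel_mono a, Category.assoc, Category.assoc, ← hp.w, reassoc_of% huv])⟩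
  refine IsDeflation.isConflation (E.comp_deflation r d ⟨K, κ, hκ⟩ ⟨X, a, h⟩)
    (by rw [reassoc_of% hp.w, h.zero, comp_zero]) fun A f hf => ?_
  obtain ⟨u, hu⟩ := h.exists_lift (f ≫ r) (by rw [Category.assoc, hf])
  exact ⟨hp.lift f u hu.symm, by simp⟩

/-- Morphisms between third terms lift to conflations with projective middle terms. -/
lemma IsConflation.exists_map {Y P S' Y₁ P₁ S₁ : C} {j : Y ⟶ P} {d : P ⟶ S'} {j₁ : Y₁ ⟶ P₁}
    {d₁ : P₁ ⟶ S₁} (h : E.IsConflation j d) (hP : E.IsProj P) (h₁ : E.IsConflation j₁ d₁)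
    (σ : S' ⟶ S₁) : ∃ (p : P ⟶ P₁) (ω : Y ⟶ Y₁), p ≫ d₁ = d ≫ σ ∧ ω ≫ j₁ = j ≫ p := by
  obtain ⟨p, hp⟩ := hP d₁ ⟨_, _, h₁⟩ (d ≫ σ)
  obtain ⟨ω, hω⟩ := h₁.exists_lift (j ≫ p) (by
    rw [Category.assoc, hp, reassoc_of% h.zero, zero_comp])
  exact ⟨p, ω, hp, hω⟩

/-- Applied to differences, this says that the map induced on syzygies is unique modulo `U`: a map
`P ⟶ P₁` vanishing in `S₁` lands in `Y₁`, so the induced map factors through `P`. -/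
lemma IsConflation.factorRel_of_map_zero {Y P Y₁ P₁ S₁ : C} {j : Y ⟶ P} {j₁ : Y₁ ⟶ P₁} {d₁ : P₁ ⟶ S₁} (hP : U P) (h₁ : E.IsConflation j₁ d₁) {p : P ⟶ P₁} {ω : Y ⟶ Y₁}
    (hp : p ≫ d₁ = 0) (hω : ω ≫ j₁ = j ≫ p) : factorRel U ω 0 := by
  obtain ⟨p', hp'⟩ := h₁.exists_lift p hp
  have := h₁.mono
  have : ω = j ≫ p' := by rw [← cancel_mono j₁, hω, Category.assoc, hp']
  exact this ▸ factorRel_of_mem hP _ _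

section Heart

variable (hST : E.IsCotorsionPair S T) (hUV : E.IsCotorsionPair U V) (hSU : S ≤ U) (hUT : U ≤ T)

include hUV in
lemma syzygy_le_embedsInto : E.syzygy S ≤ E.embedsInto U S := by
  rintro X ⟨P, S', i, d, hP, hS', hid⟩
  exact ⟨P, S', i, d, hUV.mem_left_of_isProj hP, hS', hid⟩

include hST hUT in
/-- A morphism which is zero modulo `U` extends along an inflation with cokernel in `S` to a
morphism which is zero modulo `U`. -/
lemma exists_extension_of_factorRel {X M S' Z : C} {i : X ⟶ M} {d : M ⟶ S'}
    (hid : E.IsConflation i d) (hS' : S S') {f : X ⟶ Z} (hf : factorRel U f 0) :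
    ∃ g : M ⟶ Z, i ≫ g = f ∧ factorRel U g 0 := by
  obtain ⟨A, a, b, hA, hab⟩ := factorRel_zero_iff.1 hf
  obtain ⟨c, hc⟩ := hid.exists_extension (hST.ext_vanishes _ _ hS' (hUT _ hA)) a
  exact ⟨c ≫ b, by rw [reassoc_of% hc, hab], factorRel_of_mem hA _ _⟩

include hST hUT in
/-- The morphism `Y ⟶ X` induced from a projective cover of the middle term is an epimorphism
in the heart. -/
lemma epiMod_of_cover {H : ObjectProperty C} {X W' S' P K Y : C} {a : X ⟶ W'}
    (hW' : U W') (hS' : S S') {k : K ⟶ Y} {j : Y ⟶ P} {y : Y ⟶ X} {r : P ⟶ W'} {e : P ⟶ S'}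
    (hky : E.IsConflation k y) (hj : E.IsConflation j e) (hkj : E.IsConflation (k ≫ j) r)
    (hw : j ≫ r = y ≫ a) : EpiMod H U y := by
  intro Z _ z hz
  obtain ⟨g, hg, -⟩ := exists_extension_of_factorRel hST hUT hj hS' hz
  obtain ⟨n, hn⟩ := hkj.exists_desc g (by
    rw [Category.assoc, hg, reassoc_of% hky.zero, zero_comp])
  have := hky.epi
  have : z = a ≫ n := by rw [← cancel_epi y, ← reassoc_of% hw, hn, hg]
  exact this ▸ factorRel_of_mem hW' _ _

include hST hUV hSU hUT

/-- In a pushout of `A ↣ W' ↠ S'` along `f : A ⟶ B` the morphism `c : B ⟶ D` is a cokernel of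
`f` in the heart. -/
lemma cokernelMod_of_isPushout {H : ObjectProperty C} {A W' S' B D : C} {a : A ⟶ W'}
    {d : W' ⟶ S'} (h : E.IsConflation a d) (hW' : U W') (hS' : S S') {f : A ⟶ B} {w : W' ⟶ D}
    {c : B ⟶ D} (hp : IsPushout a f w c) : CokernelMod H U f c := by
  obtain ⟨e, -, he⟩ := h.pushout hp
  refine ⟨?_, fun Z _ z hz => ?_, fun Z _ t ht => ?_⟩
  · rw [← hp.w]
    exact factorRel_of_mem hW' _ _
  · obtain ⟨g, hg, hg'⟩ := exists_extension_of_factorRel hST hUT he hS' hz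
    obtain ⟨n, hn⟩ := he.exists_desc (z - g) (by rw [Preadditive.comp_sub, hg, sub_self])
    -- `z` is the sum of `g` and a map through `S'`, and both vanish modulo `U`.
    have := (factorRel_of_mem (hSU _ hS') e n).add hUV.left hg'
    rwa [hn, sub_add_cancel, add_zero] at this
  · obtain ⟨g, hg, hg'⟩ := exists_extension_of_factorRel hST hUT h hS' ht
    exact ⟨hp.desc g t hg, by simpa using factorRel_refl hUV.left t⟩

/-- An epimorphism has zero cokernel: `f ≫ c` vanishes modulo `U`, hence so does `c`, hence so does
the identity of `D`. -/
lemma mem_of_epiMod {A W' S' B D : C} {a : A ⟶ W'} {d : W' ⟶ S'} (h : E.IsConflation a d)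
    (hW' : U W') (hS' : S S') {f : A ⟶ B} {w : W' ⟶ D} {c : B ⟶ D} (hp : IsPushout a f w c)
    (hB : E.embedsInto U S B) (hf : EpiMod (E.embedsInto U S) U f) : U D := by
  obtain ⟨e, -, he⟩ := h.pushout hp
  have hc := cokernelMod_of_isPushout (H := E.embedsInto U S) hST hUV hSU hUT h hW' hS' hp
  have hD : E.embedsInto U S D := embedsInto_of_conflation hST hUV.left hSU hUT he hS' hB
  refine hUV.mem_left_of_factorRel (hc.2.1 hD _ ?_)
  simpa using hf hD _ hc.1

/-- The pushout `D` of `f` lies in `U`, so `g ≫ c` extends to `P`. Projectivity of `P` corrects this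
extension by a map through `W'`, and the restriction of that correction to `X` is the required lift.
-/
lemma projMod_of_syzygy {X : C} (hX : E.syzygy S X) : ProjMod (E.embedsInto U S) U X := by
  obtain ⟨P, S₀, i, q, hP, hS₀, hiq⟩ := hX
  intro A B hA hB f hf g
  obtain ⟨W', S', a, d, hW', hS', had⟩ := hA
  obtain ⟨D, w, c, hp⟩ := had.exists_isPushout f
  obtain ⟨e, hwe, hce⟩ := had.pushout hp
  have hD : U D := mem_of_epiMod hST hUV hSU hUT had hW' hS' hp hB hf
  obtain ⟨p, hpc⟩ := hiq.exists_extension (hST.ext_vanishes _ _ hS₀ (hUT _ hD)) (g ≫ c)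
  obtain ⟨s, hs⟩ := hP d ⟨_, _, had⟩ (p ≫ e)
  -- After the correction the map vanishes in `S'` and lands in `B`; on `X` it is `g - t ≫ f`, which
  -- therefore factors through `P`.
  obtain ⟨b, hb⟩ := hce.exists_lift (p - s ≫ w) (by
    rw [Preadditive.sub_comp, Category.assoc, hwe, hs, sub_self])
  obtain ⟨t, ht⟩ := had.exists_lift (i ≫ s) (by
    rw [Category.assoc, hs, reassoc_of% hpc, hce.zero, comp_zero])
  have := hce.mono
  refine ⟨t, P, -i, b, hUV.mem_left_of_isProj hP, ?_⟩
  rw [← cancel_mono c, Preadditive.sub_comp, Category.assoc t f c, ← hp.w, reassoc_of% ht,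
    Category.assoc, hb, ← hpc]
  simp only [Preadditive.comp_sub, Preadditive.neg_comp]
  abel

-- Projectivity splits the epimorphism from the syzygy of `S'` obtained by covering `W'` with a
-- projective.
omit hSU in
lemma exists_retract_of_projMod (hproj : E.HasEnoughProj) {X : C} (hX : E.embedsInto U S X)
    (hX' : ProjMod (E.embedsInto U S) U X) :
    ∃ (Y P S' : C) (j : Y ⟶ P) (d : P ⟶ S'), E.IsProj P ∧ S S' ∧ E.IsConflation j d ∧
      ∃ (s : X ⟶ Y) (r : Y ⟶ X), factorRel U (s ≫ r) (𝟙 X) := by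
  obtain ⟨W', S', a, d, hW', hS', had⟩ := id hX
  obtain ⟨P, K, Y, k, j, y, r, hP, hky, hj, hkj, hw⟩ := had.exists_cover hproj
  have hY : E.embedsInto U S Y := syzygy_le_embedsInto hUV _ ⟨P, S', j, _, hP, hS', hj⟩
  obtain ⟨t, ht⟩ := hX' hY hX y (epiMod_of_cover hST hUT hW' hS' hky hj hkj hw) (𝟙 X)
  exact ⟨Y, P, S', j, _, hP, hS', hj, t, y, ht⟩

omit hSU in
/-- A retract of a syzygy of a local object is zero or isomorphic to this syzygy modulo `U`. -/
lemma isoMod_of_retract_of_isLocalObject {X Y P A : C} (hX : ¬ U X) {j : Y ⟶ P} {d : P ⟶ A}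
    (hjd : E.IsConflation j d) (hP : E.IsProj P) (hSA : S A) (hA : IsLocalObject A)
    {s : X ⟶ Y} {r : Y ⟶ X} (hsr : factorRel U (s ≫ r) (𝟙 X)) : IsoMod U X Y := by
  have hPU := hUV.mem_left_of_isProj hP
  have hU := hUV.left
  have hidem : factorRel U ((r ≫ s) ≫ r ≫ s) (r ≫ s) := by
    have := (hsr.comp_right s).comp_left r
    simpa only [Category.assoc, Category.id_comp] using this
  -- The endomorphism `r ≫ s`, idempotent modulo `U`, extends to `P` since `P` lies in `U ≤ T`, and
  -- so induces `σ` on the local object `A`.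
  obtain ⟨p, hp⟩ := hjd.exists_extension (hST.ext_vanishes _ _ hSA (hUT _ hPU)) ((r ≫ s) ≫ j)
  obtain ⟨σ, hσ⟩ := hjd.exists_desc (p ≫ d) (by rw [reassoc_of% hp, hjd.zero]; simp)
  -- Lifting the inverse of `σ` gives a right inverse `ω` of `e` modulo `U`; an idempotent with a
  -- one-sided inverse is the identity.
  have inverse : ∀ (e : Y ⟶ Y) (p : P ⟶ P) (σ : A ⟶ A), j ≫ p = e ≫ j → d ≫ σ = p ≫ d →
      IsIso σ → factorRel U (e ≫ e) e → factorRel U e (𝟙 Y) := by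
    intro e p σ hp hσ _ he
    obtain ⟨p', ω, hp', hω⟩ := hjd.exists_map hP hjd (inv σ)
    have h1 : factorRel U (e ≫ ω) (𝟙 Y) := by
      rw [factorRel_iff_sub]
      refine hjd.factorRel_of_map_zero (j := j) hPU (p := p ≫ p' - 𝟙 P) ?_ ?_
      · rw [Preadditive.sub_comp, Category.assoc, hp', ← reassoc_of% hσ]
        simp
      · rw [Preadditive.sub_comp, Category.assoc, hω, ← reassoc_of% hp]
        simp
    have h2 := h1.comp_left e
    have h3 := he.comp_right ω
    rw [Category.comp_id] at h2
    rw [Category.assoc] at h3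
    exact h2.symm.trans hU (h3.trans hU h1)
  rcases hA.2 σ with h | h
  · exact ⟨s, r, hsr, inverse _ p σ hp hσ h hidem⟩
  -- Here the complementary idempotent is the identity, so `r ≫ s` vanishes and `X` would lie in
  -- `U`.
  · have he : factorRel U (𝟙 Y - r ≫ s) (𝟙 Y) := by
      refine inverse _ (𝟙 P - p) (𝟙 A - σ) ?_ ?_ h ?_
      · rw [Preadditive.comp_sub, hp, Preadditive.sub_comp]
        simp
      · rw [Preadditive.comp_sub, hσ, Preadditive.sub_comp]
        simp
      · have := (factorRel_refl hU (𝟙 Y - r ≫ s - r ≫ s)).add hU hidem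
        convert this using 1
        · simp only [Preadditive.comp_sub, Preadditive.sub_comp, Category.comp_id,
            Category.id_comp]
          abel
        · abel
    have he' : factorRel U (r ≫ s) 0 := by
      have := (factorRel_refl hU (𝟙 Y)).sub hU he
      simpa using this
    refine (hX (hUV.mem_left_of_factorRel ?_)).elim
    have h1 : factorRel U (s ≫ r ≫ s ≫ r) 0 := by
      simpa using (he'.comp_right r).comp_left s
    have h2 := hsr.comp_left (s ≫ r)
    rw [Category.comp_id, Category.assoc] at h2
    exact hsr.symm.trans hU (h2.symm.trans hU h1)

-- Induction over the local summands of `A`: a local object that is a retract of a sum is a retract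
-- of one of the terms.
omit hSU in
lemma exists_isoMod_of_retract (hproj : E.HasEnoughProj) {X : C} (hX : IsLocalObject X)
    (hXU : ¬ U X) {A : C} (hA : IsSumOfLocals A) :
    ∀ {Y P : C} {j : Y ⟶ P} {d : P ⟶ A} (_ : E.IsConflation j d) (_ : E.IsProj P) (_ : S A)
      {s : X ⟶ Y} {r : Y ⟶ X} (_ : factorRel U (s ≫ r) (𝟙 X)),
      ∃ Y' : C, E.syzygy S Y' ∧ IsoMod U X Y' := by
  have hU := hUV.left
  induction hA with
  | zero A hA =>
    intro Y P j d hjd hP hSA s r hsr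
    have hPU := hUV.mem_left_of_isProj hP
    refine (hXU (hUV.mem_left_of_factorRel ?_)).elim
    obtain ⟨u, hu⟩ := hjd.exists_lift (𝟙 P) (hA.eq_of_tgt _ _)
    have := hjd.mono
    have : s ≫ r = (s ≫ j) ≫ (u ≫ r) := by
      have : j ≫ u = 𝟙 Y := by rw [← cancel_mono j]; simp [hu]
      rw [Category.assoc, reassoc_of% this]
    exact hsr.symm.trans hU (this ▸ factorRel_of_mem hPU _ _)
  | cons A A₁ A₂ hA₁ hA₂ φ ih =>
    intro Y P j d hjd hP hSA s r hsr
    have hS₁ : S A₁ := hST.left.summand _ _ _ ⟨φ⟩ hSA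
    have hS₂ : S A₂ := hST.left.summand _ _ _ ⟨φ ≪≫ biprod.braiding _ _⟩ hSA
    obtain ⟨P₁, d₁, hP₁, Y₁, j₁, h₁⟩ := hproj A₁
    obtain ⟨P₂, d₂, hP₂, Y₂, j₂, h₂⟩ := hproj A₂
    obtain ⟨p, ω, hp, hω⟩ := hjd.exists_map hP (h₁.sum h₂) φ.hom
    have hPP : E.IsProj (P₁ ⊞ P₂) := fun X Y f hf g => by
      obtain ⟨u, hu⟩ := hP₁ f hf (biprod.inl ≫ g)
      obtain ⟨v, hv⟩ := hP₂ f hf (biprod.inr ≫ g)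
      exact ⟨biprod.desc u v, by ext <;> simp [hu, hv]⟩
    obtain ⟨p', ω', hp', hω'⟩ := (h₁.sum h₂).exists_map hPP hjd φ.inv
    -- As in Schanuel's lemma, replacing `P` by a projective adapted to the decomposition of `A`
    -- loses nothing modulo `U`.
    have hωω : factorRel U (ω ≫ ω') (𝟙 Y) := by
      rw [factorRel_iff_sub]
      refine hjd.factorRel_of_map_zero (j := j) (hUV.mem_left_of_isProj hP)
        (p := p ≫ p' - 𝟙 P) ?_ ?_
      · rw [Preadditive.sub_comp, Category.assoc, hp', reassoc_of% hp]
        simp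
      · rw [Preadditive.sub_comp, Category.assoc, hω', reassoc_of% hω]
        simp
    have hret : factorRel U ((s ≫ ω) ≫ (ω' ≫ r)) (𝟙 X) := by
      have := (hωω.comp_right r).comp_left s
      simp only [Category.assoc, Category.id_comp] at this ⊢
      exact this.trans hU hsr
    have hsum : (s ≫ ω) ≫ (ω' ≫ r) = ((s ≫ ω) ≫ biprod.fst) ≫ biprod.inl ≫ ω' ≫ r +
        ((s ≫ ω) ≫ biprod.snd) ≫ biprod.inr ≫ ω' ≫ r := by
      rw [Category.assoc (s ≫ ω) biprod.fst, Category.assoc (s ≫ ω) biprod.snd,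
        ← Preadditive.comp_add, ← Category.assoc biprod.fst, ← Category.assoc biprod.snd,
        ← Preadditive.add_comp, biprod.total, Category.id_comp]
    have unit : ∀ {Z : C} (u : X ⟶ Z) (v : Z ⟶ X) (w : X ⟶ X) (_ : IsIso w),
        factorRel U (u ≫ v) w → factorRel U (u ≫ v ≫ inv w) (𝟙 X) := by
      intro Z u v w _ h
      simpa using h.comp_right (inv w)
    -- If the component through `Y₁` is not invertible, its complement is, and this agrees modulo
    -- `U` with the component through `Y₂`.
    rcases hX.2 (((s ≫ ω) ≫ biprod.fst) ≫ biprod.inl ≫ ω' ≫ r) with h | h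
    · exact ⟨Y₁, ⟨P₁, A₁, j₁, d₁, hP₁, hS₁, h₁⟩,
        isoMod_of_retract_of_isLocalObject hST hUV hUT hXU h₁ hP₁ hS₁ hA₁
          (unit _ _ _ h (factorRel_refl hU _))⟩
    · refine ih h₂ hP₂ hS₂ (unit ((s ≫ ω) ≫ biprod.snd) (biprod.inr ≫ ω' ≫ r) _ h ?_)
      have := hret.sub hU (factorRel_refl hU (((s ≫ ω) ≫ biprod.fst) ≫ biprod.inl ≫ ω' ≫ r))
      rwa [hsum, add_sub_cancel_left] at this

/-- The heart and projectivity pass to summands, so local summands can be treated one at a time;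
those in `U` are replaced by a zero object. -/
lemma exists_isoMod_of_projMod (hproj : E.HasEnoughProj) (hKS : ∀ X : C, IsSumOfLocals X) {X : C}
    (hX : E.embedsInto U S X) (hX' : ProjMod (E.embedsInto U S) U X) :
    ∃ Y : C, E.syzygy S Y ∧ IsoMod U X Y := by
  have hU := hUV.left
  induction hKS X with
  | zero X h =>
    exact ⟨X, syzygy_of_isZero hST.left h, .of_iso hU (Iso.refl _)⟩
  | cons X A B hA hB φ ih =>
    have mem : ∀ {A : C} (s : A ⟶ X) (r : X ⟶ A), s ≫ r = 𝟙 A → E.embedsInto U S A ∧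
        ProjMod (E.embedsInto U S) U A := fun {A} s r hsr => by
      refine ⟨embedsInto_of_retract hST hUV hSU hUT s r hsr hX, fun M N hM hN f hf g => ?_⟩
      obtain ⟨t, ht⟩ := hX' hM hN f hf (r ≫ g)
      refine ⟨s ≫ t, ?_⟩
      have := ht.comp_left s
      rwa [reassoc_of% hsr, ← Category.assoc] at this
    obtain ⟨hAH, hAP⟩ := mem (biprod.inl ≫ φ.inv) (φ.hom ≫ biprod.fst) (by simp)
    obtain ⟨hBH, hBP⟩ := mem (biprod.inr ≫ φ.inv) (φ.hom ≫ biprod.snd) (by simp)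
    obtain ⟨Y₂, hY₂, e₂⟩ := ih hBH hBP
    have : ∃ Y₁, E.syzygy S Y₁ ∧ IsoMod U A Y₁ := by
      by_cases hAU : U A
      · obtain ⟨Z, hZ, hZU⟩ := hU.zero.exists_zero
        exact ⟨Z, syzygy_of_isZero hST.left hZ, isoMod_of_mem hAU hZU⟩
      · obtain ⟨Y, P, S', j, d, hP, hS', hjd, s, r, hsr⟩ :=
          exists_retract_of_projMod hST hUV hUT hproj hAH hAP
        exact exists_isoMod_of_retract hST hUV hUT hproj hA hAU (hKS S') hjd hP hS' hsr
    obtain ⟨Y₁, hY₁, e₁⟩ := this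
    exact ⟨Y₁ ⊞ Y₂, syzygy_sum hST.left hY₁ hY₂, (IsoMod.of_iso hU φ).trans hU (e₁.biprod hU e₂)⟩

lemma projMod_iff (hproj : E.HasEnoughProj) (hKS : ∀ X : C, IsSumOfLocals X) {X : C}
    (hX : E.embedsInto U S X) :
    ProjMod (E.embedsInto U S) U X ↔ ∃ Y : C, E.syzygy S Y ∧ IsoMod U X Y := by
  refine ⟨exists_isoMod_of_projMod hST hUV hSU hUT hproj hKS hX, ?_⟩
  rintro ⟨Y, hY, e⟩
  exact (projMod_of_syzygy hST hUV hSU hUT hY).of_isoMod hUV.left e.symm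

/-- An object of the heart which embeds into `S` with cokernel in `S` is a cokernel of a morphism
between syzygies. -/
lemma exists_cokernelMod (hproj : E.HasEnoughProj) {X : C} (hX : E.embedsInto S S X) :
    ∃ (A P : C) (φ : A ⟶ P) (δ : P ⟶ X), E.syzygy S A ∧ E.syzygy S P ∧
      CokernelMod (E.embedsInto U S) U φ δ := by
  obtain ⟨S₁, S₂, a, d, hS₁, hS₂, had⟩ := hX
  obtain ⟨P, K, Y, k, j, y, r, hP, hky, hj, hkj, hw⟩ := had.exists_cover hproj
  refine ⟨K, Y, k, y, ⟨P, S₁, _, _, hP, hS₁, hkj⟩, ⟨P, S₂, _, _, hP, hS₂, hj⟩, ?_,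
    epiMod_of_cover hST hUT (hSU _ hS₁) hS₂ hky hj hkj hw, fun Z hZ t ht => ?_⟩
  · rw [hky.zero]
    exact factorRel_refl hUV.left _
  -- Subtracting `j ≫ g`, which vanishes modulo `U`, makes `t` vanish on `K` exactly, so that it
  -- descends along `y`.
  · obtain ⟨g, hg, hg'⟩ := exists_extension_of_factorRel hST hUT hkj hS₁ ht
    obtain ⟨t', ht'⟩ := hky.exists_desc (t - j ≫ g) (by
      rw [Preadditive.comp_sub, ← hg, Category.assoc, sub_self])
    refine ⟨t', ?_⟩
    have := (factorRel_refl hUV.left t).sub hUV.left (hg'.comp_left j)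
    rwa [comp_zero, sub_zero, ← ht'] at this

lemma exists_isoMod_embedsInto (hKS : ∀ X : C, IsSumOfLocals X)
    (h : ∀ B : C, IsLocalObject B → E.embedsInto U S B → ¬ U B → E.embedsInto S S B)
    {X : C} (hX : E.embedsInto U S X) : ∃ Y : C, E.embedsInto S S Y ∧ IsoMod U X Y := by
  have hU := hUV.left
  have zero : ∀ {X : C}, IsZero X → E.embedsInto S S X := fun {X} hX =>
    ⟨X, X, 𝟙 X, 0, hST.left.of_isZero hX, hST.left.of_isZero hX, E.isConflation_id_zero X hX⟩
  induction hKS X with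
  | zero X h => exact ⟨X, zero h, .of_iso hU (Iso.refl _)⟩
  | cons X A B hA hB φ ih =>
    obtain ⟨Y₂, hY₂, e₂⟩ := ih (embedsInto_of_retract hST hUV hSU hUT (biprod.inr ≫ φ.inv)
      (φ.hom ≫ biprod.snd) (by simp) hX)
    have : ∃ Y₁, E.embedsInto S S Y₁ ∧ IsoMod U A Y₁ := by
      by_cases hAU : U A
      · obtain ⟨Z, hZ, hZU⟩ := hU.zero.exists_zero
        exact ⟨Z, zero hZ, isoMod_of_mem hAU hZU⟩
      · exact ⟨A, h A hA (embedsInto_of_retract hST hUV hSU hUT (biprod.inl ≫ φ.inv)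
          (φ.hom ≫ biprod.fst) (by simp) hX) hAU, .of_iso hU (Iso.refl _)⟩
    obtain ⟨Y₁, hY₁, e₁⟩ := this
    exact ⟨Y₁ ⊞ Y₂, embedsInto_sum hST.left hST.left hY₁ hY₂,
      (IsoMod.of_iso hU φ).trans hU (e₁.biprod hU e₂)⟩

omit hST hSU hUT in
/-- A local object which is isomorphic modulo `U` to `D` is a retract of `D`, unless it is
in `U`. -/
lemma exists_retract_of_isoMod {B D : C} (hB : IsLocalObject B) (hBU : ¬ U B)
    (e : IsoMod U B D) : ∃ (s : B ⟶ D) (r : D ⟶ B), s ≫ r = 𝟙 B := by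
  obtain ⟨f, g, ⟨Z, a, b, hZ, hab⟩, -⟩ := e
  -- Since `𝟙 B - f ≫ g` factors through `U`, its invertibility would put `B` in `U`; hence `f ≫ g`
  -- is invertible in the exact category itself.
  rcases hB.2 (f ≫ g) with h | h
  · exact ⟨f, g ≫ inv (f ≫ g), by rw [← Category.assoc, IsIso.hom_inv_id]⟩
  · have : 𝟙 B - f ≫ g = a ≫ (-b) := by rw [Preadditive.comp_neg, hab, neg_sub]
    rw [this] at h
    exact (hBU (hUV.mem_left_of_retract hZ a ((-b) ≫ inv (a ≫ (-b)))
      (by rw [← Category.assoc, IsIso.hom_inv_id]))).elim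

lemma enoughProjMod_iff (hproj : E.HasEnoughProj) (hKS : ∀ X : C, IsSumOfLocals X) :
    EnoughProjMod (E.embedsInto U S) U ↔
      ∀ B : C, IsLocalObject B → E.embedsInto U S B → ¬ U B → E.embedsInto S S B := by
  have hU := hUV.left
  have hST' : S ≤ T := hSU.trans hUT
  constructor
  · intro h B hB hBH hBU
    obtain ⟨A, P, φ, δ, hA, hP, hPP, hδ⟩ := h B hBH
    obtain ⟨Y, hY, f, g, hfg, hgf⟩ :=
      (projMod_iff hST hUV hSU hUT hproj hKS hP).1 hPP
    have hYH := syzygy_le_embedsInto hUV _ hY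
    obtain ⟨W', S', a, d, hW', hS', had⟩ := hA
    -- The cokernel computed by pushout keeps control of the underlying object: `Y ↣ D ↠ S'` with
    -- `Y` a syzygy, so `D` inherits an embedding into `S`.
    obtain ⟨D, w, c, hp⟩ := had.exists_isPushout (φ ≫ f)
    obtain ⟨e, -, he⟩ := had.pushout hp
    have hYS : E.embedsInto S S Y := by
      obtain ⟨Q, S₀, i, q, hQ, hS₀, hiq⟩ := hY
      exact ⟨Q, S₀, i, q, hST.mem_left_of_isProj hQ, hS₀, hiq⟩
    have hDH : E.embedsInto U S D := embedsInto_of_conflation hST hU hSU hUT he hS' hYH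
    have hDS : E.embedsInto S S D :=
      embedsInto_of_conflation hST hST.left le_rfl hST' he hS' hYS
    have hc := cokernelMod_of_isPushout (H := E.embedsInto U S) hST hUV hSU hUT had hW' hS' hp
    have hgδ : CokernelMod (E.embedsInto U S) U (φ ≫ f) (g ≫ δ) := by
      refine ⟨?_, fun Z hZ z hz => ?_, fun Z hZ t ht => ?_⟩
      · have := (hfg.comp_right δ).comp_left φ
        simp only [Category.assoc, Category.id_comp] at this ⊢
        exact this.trans hU hδ.1
      · refine hδ.2.1 hZ z ?_
        have h1 := hz.comp_left f
        have h2 := hfg.comp_right (δ ≫ z)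
        simp only [Category.assoc, Category.id_comp, comp_zero] at h1 h2
        exact h2.symm.trans hU h1
      · obtain ⟨t', ht'⟩ := hδ.2.2 hZ (f ≫ t) (by simpa using ht)
        refine ⟨t', ?_⟩
        have h1 := ht'.comp_left g
        have h2 := hgf.comp_right t
        simp only [Category.assoc, Category.id_comp] at h1 h2 ⊢
        exact h1.trans hU h2
    obtain ⟨s, r, hsr⟩ := exists_retract_of_isoMod hUV hB hBU
      (hgδ.isoMod hU hBH hDH hc)
    exact embedsInto_of_retract hST hST le_rfl hST' s r hsr hDS
  · intro h X hX
    obtain ⟨Y, hY, e⟩ := exists_isoMod_embedsInto hST hUV hSU hUT hKS h hX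
    obtain ⟨f, g, hfg, hgf⟩ := e
    obtain ⟨A, P, φ, δ, hA, hP, hδ⟩ := exists_cokernelMod (U := U) hST hUV hSU hUT hproj hY
    exact ⟨A, P, φ, δ ≫ g, syzygy_le_embedsInto hUV _ hA, syzygy_le_embedsInto hUV _ hP,
      projMod_of_syzygy hST hUV hSU hUT hP, hδ.comp_isoMod hU hgf hfg⟩

end Heart

end ExactStructure

/-! ### Duality -/

section Opposite

open Opposite

variable {C : Type*} [Category* C] [Preadditive C] [HasFiniteBiproducts C]

lemma hasFiniteBiproducts_opposite : HasFiniteBiproducts Cᵒᵖ :=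
  HasFiniteBiproducts.of_hasFiniteProducts

attribute [local instance] hasFiniteBiproducts_opposite

/-- Biproducts in the opposite category. -/
noncomputable def biprodUnopIso (X Y : Cᵒᵖ) : (X ⊞ Y).unop ≅ X.unop ⊞ Y.unop where
  hom := biprod.lift (biprod.inl : X ⟶ X ⊞ Y).unop (biprod.inr : Y ⟶ X ⊞ Y).unop
  inv := biprod.desc (biprod.fst : X ⊞ Y ⟶ X).unop (biprod.snd : X ⊞ Y ⟶ Y).unop
  hom_inv_id := by
    rw [biprod.lift_desc, ← unop_comp, ← unop_comp, ← unop_add, biprod.total, unop_id]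
  inv_hom_id := by
    ext
    · simp [← unop_comp]
    · simp [← unop_comp]
    · simp [← unop_comp]
    · simp [← unop_comp]

/-- Direct sums of short complexes in the opposite category. -/
noncomputable def shortComplexSumUnopIso (S S' : ShortComplex Cᵒᵖ) :
    (shortComplexSum S S').unop ≅ shortComplexSum S.unop S'.unop :=
  have key : ∀ {X Y X' Y' : Cᵒᵖ} (f : X ⟶ Y) (f' : X' ⟶ Y'),
      (biprodUnopIso Y Y').hom ≫ biprod.map f.unop f'.unop =
        (biprod.map f f').unop ≫ (biprodUnopIso X X').hom := fun f f' => by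
    ext
    · simp [biprodUnopIso, ← unop_comp]
    · simp [biprodUnopIso, ← unop_comp]
  ShortComplex.isoMk (biprodUnopIso _ _) (biprodUnopIso _ _) (biprodUnopIso _ _)
    (key S.g S'.g) (key S.f S'.f)

namespace ExactStructure

variable (E : ExactStructure C)

/-- The opposite of an exact structure. -/
def op : ExactStructure Cᵒᵖ where
  conflation S := E.conflation S.unop
  isKernel S hS := by
    have h : E.IsConflation S.unop.f S.unop.g := ⟨_, hS⟩
    have : Epi S.f.unop := h.epi
    have : Mono S.f := by rw [← S.f.op_unop]; infer_instance
    refine ⟨KernelFork.IsLimit.ofι' _ _ fun {A} k hk => ?_⟩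
    have h' := h.exists_desc k.unop (congrArg Quiver.Hom.unop hk)
    exact ⟨h'.choose.op, Quiver.Hom.unop_inj h'.choose_spec⟩
  isCokernel S hS := by
    have h : E.IsConflation S.unop.f S.unop.g := ⟨_, hS⟩
    have : Mono S.g.unop := h.mono
    have : Epi S.g := by rw [← S.g.op_unop]; infer_instance
    refine ⟨CokernelCofork.IsColimit.ofπ' _ _ fun {A} k hk => ?_⟩
    have h' := h.exists_lift k.unop (congrArg Quiver.Hom.unop hk)
    exact ⟨h'.choose.op, Quiver.Hom.unop_inj h'.choose_spec⟩
  of_iso S S' e h := by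
    obtain ⟨e⟩ := e
    exact E.of_iso S.unop S'.unop ⟨((ShortComplex.unopFunctor C).mapIso e).unop.symm⟩ h
  sum S S' h h' := E.of_iso _ _ ⟨(shortComplexSumUnopIso S S').symm⟩ (E.sum _ _ h h')
  summand S S' h := E.summand _ _ (E.of_iso _ _ ⟨shortComplexSumUnopIso S S'⟩ h)
  id_inflation X := by
    obtain ⟨Z, i, w, h⟩ := E.id_deflation X.unop
    exact ⟨_, i.op, Quiver.Hom.unop_inj w, h⟩
  id_deflation X := by
    obtain ⟨Z, i, w, h⟩ := E.id_inflation X.unop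
    exact ⟨_, i.op, Quiver.Hom.unop_inj w, h⟩
  comp_inflation := by
    rintro X Y Z i j ⟨Q, d, w, h⟩ ⟨Q', d', w', h'⟩
    obtain ⟨K, k, wk, hk⟩ := E.comp_deflation j.unop i.unop
      ⟨_, d'.unop, congrArg Quiver.Hom.unop w', h'⟩ ⟨_, d.unop, congrArg Quiver.Hom.unop w, h⟩
    exact ⟨_, k.op, Quiver.Hom.unop_inj wk, hk⟩
  comp_deflation := by
    rintro X Y Z i j ⟨Q, d, w, h⟩ ⟨Q', d', w', h'⟩
    obtain ⟨K, k, wk, hk⟩ := E.comp_inflation j.unop i.unop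
      ⟨_, d'.unop, congrArg Quiver.Hom.unop w', h'⟩ ⟨_, d.unop, congrArg Quiver.Hom.unop w, h⟩
    exact ⟨_, k.op, Quiver.Hom.unop_inj (by simpa using wk), hk⟩
  pullback_deflation := by
    rintro S hS Z' f
    obtain ⟨Y', g', i', hp, Q, d, w, h⟩ := E.pushout_inflation S.unop hS f.unop
    exact ⟨_, g'.op, i'.op, hp.op.flip, _, d.op, Quiver.Hom.unop_inj w, h⟩
  pushout_inflation := by
    rintro S hS Z' f
    obtain ⟨Y', g', i', hp, Q, d, w, h⟩ := E.pullback_deflation S.unop hS f.unop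
    exact ⟨_, g'.op, i'.op, hp.op.flip, _, d.op, Quiver.Hom.unop_inj w, h⟩

variable {E}

lemma isConflation_op_iff {X Y Z : Cᵒᵖ} {i : X ⟶ Y} {d : Y ⟶ Z} :
    E.op.IsConflation i d ↔ E.IsConflation d.unop i.unop :=
  ⟨fun h => ⟨congrArg Quiver.Hom.unop h.1, h.2⟩, fun h => ⟨Quiver.Hom.unop_inj h.1, h.2⟩⟩

lemma IsConflation.op {X Y Z : C} {i : X ⟶ Y} {d : Y ⟶ Z} (h : E.IsConflation i d) :
    E.op.IsConflation d.op i.op :=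
  isConflation_op_iff.2 h

end ExactStructure

lemma factorRel_op_iff {D : Type*} [Category* D] [Preadditive D] {W : ObjectProperty D}
    {X Y : Dᵒᵖ} {f g : X ⟶ Y} : factorRel W.op f g ↔ factorRel W f.unop g.unop := by
  constructor
  · rintro ⟨Z, a, b, hZ, h⟩
    exact ⟨_, b.unop, a.unop, hZ, congrArg Quiver.Hom.unop h⟩
  · rintro ⟨Z, a, b, hZ, h⟩
    exact ⟨_, b.op, a.op, hZ, Quiver.Hom.unop_inj h⟩

lemma isoMod_op_iff {D : Type*} [Category* D] [Preadditive D] {W : ObjectProperty D}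
    {X Y : Dᵒᵖ} : IsoMod W.op X Y ↔ IsoMod W X.unop Y.unop := by
  constructor
  · rintro ⟨f, g, h, h'⟩
    exact ⟨g.unop, f.unop, factorRel_op_iff.1 h, factorRel_op_iff.1 h'⟩
  · rintro ⟨f, g, h, h'⟩
    exact ⟨g.op, f.op, factorRel_op_iff.2 h, factorRel_op_iff.2 h'⟩

lemma isLocalObject_op_iff {D : Type*} [Category* D] [Preadditive D] {X : D} :
    IsLocalObject (op X) ↔ IsLocalObject X := by
  refine and_congr (not_congr ⟨fun h => h.unop, fun h => h.op⟩) ⟨fun h f => ?_, fun h f => ?_⟩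
  · refine (h f.op).imp (fun h => (isIso_op_iff f).1 h) fun h => ?_
    exact (isIso_op_iff (𝟙 X - f)).1 h
  · refine (h f.unop).imp (fun h => (isIso_unop_iff f).1 h) fun h => ?_
    exact (isIso_unop_iff (𝟙 (op X) - f)).1 h

lemma IsSumOfLocals.op {X : C} (h : IsSumOfLocals X) : IsSumOfLocals (Opposite.op X) := by
  induction h with
  | zero X h => exact .zero _ h.op
  | cons X A B hA hB e ih =>
    exact .cons _ _ _ (isLocalObject_op_iff.2 hA) ih
      (e.op.symm ≪≫ (biprodUnopIso (Opposite.op A) (Opposite.op B)).op)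

lemma IsAdditiveSummandClosed.op {P : ObjectProperty C} (h : IsAdditiveSummandClosed P) :
    IsAdditiveSummandClosed P.op where
  zero := by
    obtain ⟨Z, hZ, hPZ⟩ := h.zero.exists_zero
    exact ⟨Opposite.op Z, hZ.op, hPZ⟩
  sum X Y hX hY := h.of_iso (biprodUnopIso X Y).symm (h.sum _ _ hX hY)
  summand X Y Z e hZ := by
    obtain ⟨e⟩ := e
    exact h.summand X.unop Y.unop Z.unop ⟨e.unop.symm ≪≫ biprodUnopIso X Y⟩ hZ

namespace ExactStructure

variable {E : ExactStructure C} {S T U V : ObjectProperty C}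

lemma IsCotorsionPair.op (h : E.IsCotorsionPair U V) : E.op.IsCotorsionPair V.op U.op where
  left := h.right.op
  right := h.left.op
  ext_vanishes A B hA hB Y i d w hid := by
    obtain ⟨s⟩ := h.ext_vanishes _ _ hB hA d.unop i.unop (congrArg Quiver.Hom.unop w) hid
    exact ⟨s.op⟩
  resolution B := by
    obtain ⟨V', U', i, d, hV, hU, hid⟩ := h.coresolution B.unop
    exact ⟨_, _, d.op, i.op, hU, hV, hid.op⟩
  coresolution B := by
    obtain ⟨V', U', i, d, hV, hU, hid⟩ := h.resolution B.unop
    exact ⟨_, _, d.op, i.op, hU, hV, hid.op⟩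

lemma isInflation_unop {X Y : Cᵒᵖ} {f : X ⟶ Y} (h : E.op.IsDeflation f) :
    E.IsInflation f.unop := by
  obtain ⟨K, k, hk⟩ := h
  exact ⟨_, _, isConflation_op_iff.1 hk⟩

lemma isProj_op_iff {I : Cᵒᵖ} : E.op.IsProj I ↔ E.IsInj I.unop := by
  constructor
  · rintro h X Y f ⟨Z, d, hd⟩ g
    obtain ⟨t, ht⟩ := h f.op ⟨_, _, hd.op⟩ g.op
    exact ⟨t.unop, congrArg Quiver.Hom.unop ht⟩
  · intro h X Y f hf g
    obtain ⟨t, ht⟩ := h f.unop (isInflation_unop hf) g.unop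
    exact ⟨t.op, Quiver.Hom.unop_inj ht⟩

lemma HasEnoughInj.op (h : E.HasEnoughInj) : E.op.HasEnoughProj := fun X => by
  obtain ⟨I, j, hI, Z, d, hd⟩ := h X.unop
  exact ⟨_, j.op, isProj_op_iff.2 hI, _, _, hd.op⟩

lemma syzygy_op_iff {X : Cᵒᵖ} : E.op.syzygy V.op X ↔ E.cosyzygy V X.unop := by
  constructor
  · rintro ⟨P, S', i, d, hP, hS, hid⟩
    exact ⟨_, _, _, _, hS, isProj_op_iff.1 hP, isConflation_op_iff.1 hid⟩
  · rintro ⟨P, S', i, d, hP, hS, hid⟩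
    exact ⟨_, _, _, _, isProj_op_iff.2 hS, hP, hid.op⟩

lemma embedsInto_op_iff {X : Cᵒᵖ} : E.op.embedsInto T.op V.op X ↔
    ∃ (V' W' : C) (i : V' ⟶ W') (d : W' ⟶ X.unop), V V' ∧ T W' ∧ E.IsConflation i d := by
  constructor
  · rintro ⟨P, S', i, d, hP, hS, hid⟩
    exact ⟨_, _, _, _, hS, hP, isConflation_op_iff.1 hid⟩
  · rintro ⟨P, S', i, d, hP, hS, hid⟩
    exact ⟨_, _, _, _, hS, hP, hid.op⟩

/-- The resolution by `(U, V)` has its middle term in `T ⊓ U = U`, so the condition defining the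
plus part is automatic. -/
lemma heartObj_eq_embedsInto (hUV : E.IsCotorsionPair U V) (hUT : U ≤ T) :
    E.heartObj S T U V = E.embedsInto U S := by
  have hW : T ⊓ U = U := inf_eq_right.2 hUT
  ext X
  refine ⟨fun ⟨_, W', S', i, d, hW', hS', h⟩ => ⟨W', S', i, d, hW'.2, hS', h⟩,
    fun ⟨W', S', i, d, hW', hS', h⟩ => ⟨?_, W', S', i, d, hW.symm ▸ hW', hS', h⟩⟩
  obtain ⟨V', U', i, d, hV, hU, hid⟩ := hUV.resolution X
  exact ⟨V', U', i, d, hV, hW.symm ▸ hU, hid⟩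

lemma heartObj_op_eq_embedsInto (hST : E.IsCotorsionPair S T) (hTU : T ≤ U) :
    (E.heartObj S T U V).op = E.op.embedsInto T.op V.op := by
  have hW : T ⊓ U = T := inf_eq_left.2 hTU
  ext X
  rw [embedsInto_op_iff]
  refine ⟨fun ⟨⟨V', W', i, d, hV', hW', h⟩, _⟩ => ⟨V', W', i, d, hV', hW'.1, h⟩,
    fun ⟨V', W', i, d, hV', hW', h⟩ => ⟨⟨V', W', i, d, hV', hW.symm ▸ hW', h⟩, ?_⟩⟩
  obtain ⟨T', S', i, d, hT, hS, hid⟩ := hST.coresolution X.unop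
  exact ⟨T', S', i, d, hW.symm ▸ hT, hS, hid⟩

end ExactStructure

end Opposite

lemma exists_hom_op_eq {D : Type*} [Category* D] {X Y : D}
    (f : Opposite.op X ⟶ Opposite.op Y) : ∃ g : Y ⟶ X, g.op = f :=
  ⟨f.unop, rfl⟩

/-! ### Comparison of the quotient category with representatives -/

section SubcategoryQuotient

variable {C : Type*} [Category* C] [Preadditive C] [HasFiniteBiproducts C]
  {H W : ObjectProperty C}

-- As `W` lies in `H`, factoring through `W` inside the full subcategory is the same as in the
-- ambient category.
omit [HasFiniteBiproducts C] in
lemma factorRel_inverseImage_iff (hWH : W ≤ H) {X Y : H.FullSubcategory} {f g : X ⟶ Y} :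
    factorRel (W.inverseImage H.ι) f g ↔ factorRel W f.hom g.hom := by
  constructor
  · rintro ⟨Z, a, b, hZ, h⟩
    exact ⟨Z.obj, a.hom, b.hom, hZ, congrArg (fun f => f.hom) h⟩
  · rintro ⟨Z, a, b, hZ, h⟩
    exact ⟨⟨Z, hWH _ hZ⟩, ObjectProperty.homMk a, ObjectProperty.homMk b, hZ,
      ObjectProperty.hom_ext _ h⟩

lemma congruence_factorRel_inverseImage (hW : IsAdditiveSummandClosed W) (hWH : W ≤ H) :
    Congruence (factorRel (W.inverseImage H.ι)) where
  equivalence :=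
    { refl := fun _ => (factorRel_inverseImage_iff hWH).2 (factorRel_refl hW _)
      symm := fun h => h.symm
      trans := fun h h' => (factorRel_inverseImage_iff hWH).2
        (((factorRel_inverseImage_iff hWH).1 h).trans hW ((factorRel_inverseImage_iff hWH).1 h')) }
  comp_left f _ _ h := h.comp_left f
  comp_right f h := h.comp_right f

/-- The quotient of the full subcategory `H` by the ideal of `W`. -/
abbrev SubcategoryQuotient (H W : ObjectProperty C) : Type _ :=
  IdealQuotient (W.inverseImage H.ι)

namespace SubcategoryQuotient

omit [HasFiniteBiproducts C] in
variable (W) in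
lemma exists_obj_eq {X : C} (hX : H X) : ∃ X' : SubcategoryQuotient H W, X'.as.obj = X :=
  ⟨⟨⟨X, hX⟩⟩, rfl⟩

omit [HasFiniteBiproducts C] in
variable (W) in
lemma exists_op_obj_eq {X : Cᵒᵖ} (hX : H.op X) :
    ∃ X' : SubcategoryQuotient H W, Opposite.op X'.as.obj = X :=
  ⟨⟨⟨X.unop, hX⟩⟩, rfl⟩

/-- The class of a morphism. -/
def homMk {X Y : SubcategoryQuotient H W} (f : X.as.obj ⟶ Y.as.obj) : X ⟶ Y :=
  (Quotient.functor (factorRel (W.inverseImage H.ι))).map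
    (X := X.as) (Y := Y.as) (ObjectProperty.homMk f)

omit [HasFiniteBiproducts C] in
lemma homMk_surjective {X Y : SubcategoryQuotient H W} (f : X ⟶ Y) :
    ∃ g : X.as.obj ⟶ Y.as.obj, homMk g = f := by
  obtain ⟨g, hg⟩ := (Quotient.functor (factorRel (W.inverseImage H.ι))).map_surjective
    (X := X.as) (Y := Y.as) f
  exact ⟨g.hom, hg⟩

omit [HasFiniteBiproducts C] in
lemma homMk_comp {X Y Z : SubcategoryQuotient H W} (f : X.as.obj ⟶ Y.as.obj)
    (g : Y.as.obj ⟶ Z.as.obj) : (homMk f : X ⟶ Y) ≫ (homMk g : Y ⟶ Z) = homMk (f ≫ g) := rfl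

omit [HasFiniteBiproducts C] in
lemma homMk_id (X : SubcategoryQuotient H W) : (homMk (𝟙 X.as.obj) : X ⟶ X) = 𝟙 X := rfl

omit [HasFiniteBiproducts C] in
lemma homMk_zero (X Y : SubcategoryQuotient H W) : (homMk 0 : X ⟶ Y) = 0 := rfl

variable (hW : IsAdditiveSummandClosed W) (hWH : W ≤ H)
include hW hWH

lemma homMk_eq_iff {X Y : SubcategoryQuotient H W} {f g : X.as.obj ⟶ Y.as.obj} :
    (homMk f : X ⟶ Y) = homMk g ↔ factorRel W f g := by
  have := congruence_factorRel_inverseImage hW hWH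
  refine (Quotient.functor_map_eq_iff (factorRel (W.inverseImage H.ι)) _ _).trans ?_
  exact factorRel_inverseImage_iff hWH

lemma homMk_eq_zero_iff {X Y : SubcategoryQuotient H W} {f : X.as.obj ⟶ Y.as.obj} :
    (homMk f : X ⟶ Y) = 0 ↔ factorRel W f 0 := by
  rw [← homMk_zero, homMk_eq_iff hW hWH]

lemma epi_homMk_iff {X Y : SubcategoryQuotient H W} {f : X.as.obj ⟶ Y.as.obj} :
    Epi (homMk f : X ⟶ Y) ↔ EpiMod H W f := by
  refine ⟨fun _ Z hZ z hz => ?_, fun h => ⟨fun {Z} a b hab => ?_⟩⟩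
  · obtain ⟨Z, rfl⟩ := exists_obj_eq W hZ
    rw [← homMk_eq_iff hW hWH, ← cancel_epi (homMk f : X ⟶ Y), homMk_comp, homMk_comp,
      homMk_eq_iff hW hWH]
    simpa using hz
  · obtain ⟨a, rfl⟩ := homMk_surjective a
    obtain ⟨b, rfl⟩ := homMk_surjective b
    rw [homMk_comp, homMk_comp, homMk_eq_iff hW hWH, factorRel_iff_sub] at hab
    rw [homMk_eq_iff hW hWH, factorRel_iff_sub]
    exact h Z.as.property _ (by rwa [Preadditive.comp_sub])

/-- Monomorphisms are expressed by the epimorphism predicate of the opposite category, so that the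
results on projectives apply verbatim to injectives. -/
lemma mono_homMk_iff {X Y : SubcategoryQuotient H W} {f : X.as.obj ⟶ Y.as.obj} :
    Mono (homMk f : X ⟶ Y) ↔ EpiMod H.op W.op f.op := by
  refine ⟨fun _ Z hZ z hz => ?_, fun h => ⟨fun {Z} a b hab => ?_⟩⟩
  · obtain ⟨Z, rfl⟩ := exists_op_obj_eq W hZ
    obtain ⟨z, rfl⟩ := exists_hom_op_eq z
    have hz : factorRel W (z ≫ f) 0 := factorRel_op_iff.1 hz
    refine factorRel_op_iff.2 ((homMk_eq_zero_iff hW hWH (X := Z) (Y := X)).1 ?_)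
    rw [← cancel_mono (homMk f : X ⟶ Y), homMk_comp, zero_comp, homMk_eq_zero_iff hW hWH]
    exact hz
  · obtain ⟨a, rfl⟩ := homMk_surjective a
    obtain ⟨b, rfl⟩ := homMk_surjective b
    rw [homMk_comp, homMk_comp, homMk_eq_iff hW hWH, factorRel_iff_sub] at hab
    rw [homMk_eq_iff hW hWH, factorRel_iff_sub]
    refine factorRel_op_iff.1 (h (Z := Opposite.op Z.as.obj) Z.as.property (a - b).op ?_)
    rw [← Preadditive.sub_comp] at hab
    exact factorRel_op_iff.2 hab

lemma projective_iff {X : SubcategoryQuotient H W} : Projective X ↔ ProjMod H W X.as.obj := by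
  refine ⟨fun _ A B hA hB f hf g => ?_, fun h => ⟨fun {A B} g f hf => ?_⟩⟩
  · obtain ⟨A, rfl⟩ := exists_obj_eq W hA
    obtain ⟨B, rfl⟩ := exists_obj_eq W hB
    have : Epi (homMk f : A ⟶ B) := (epi_homMk_iff hW hWH).2 hf
    obtain ⟨t, ht⟩ := Projective.factors (homMk g : X ⟶ B) (homMk f : A ⟶ B)
    obtain ⟨t, rfl⟩ := homMk_surjective t
    rw [homMk_comp, homMk_eq_iff hW hWH] at ht
    exact ⟨t, ht⟩
  · obtain ⟨f, rfl⟩ := homMk_surjective f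
    obtain ⟨g, rfl⟩ := homMk_surjective g
    obtain ⟨t, ht⟩ := h A.as.property B.as.property f ((epi_homMk_iff hW hWH).1 hf) g
    exact ⟨homMk t, by rwa [homMk_comp, homMk_eq_iff hW hWH]⟩

lemma injective_iff {X : SubcategoryQuotient H W} :
    Injective X ↔ ProjMod H.op W.op (Opposite.op X.as.obj) := by
  refine ⟨fun _ A B hA hB f hf g => ?_, fun h => ⟨fun {A B} g f hf => ?_⟩⟩
  · obtain ⟨A, rfl⟩ := exists_op_obj_eq W hA
    obtain ⟨B, rfl⟩ := exists_op_obj_eq W hB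
    obtain ⟨f, rfl⟩ := exists_hom_op_eq f
    obtain ⟨g, rfl⟩ := exists_hom_op_eq g
    have : Mono (homMk f : B ⟶ A) := (mono_homMk_iff hW hWH).2 hf
    obtain ⟨t, ht⟩ := Injective.factors (homMk g : B ⟶ X) (homMk f : B ⟶ A)
    obtain ⟨t, rfl⟩ := homMk_surjective t
    rw [homMk_comp, homMk_eq_iff hW hWH] at ht
    exact ⟨t.op, factorRel_op_iff.2 ht⟩
  · obtain ⟨f, rfl⟩ := homMk_surjective f
    obtain ⟨g, rfl⟩ := homMk_surjective g
    obtain ⟨t, ht⟩ := h (A := Opposite.op B.as.obj) (B := Opposite.op A.as.obj)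
      B.as.property A.as.property f.op ((mono_homMk_iff hW hWH).1 hf) g.op
    obtain ⟨t, rfl⟩ := exists_hom_op_eq t
    exact ⟨homMk t, by rw [homMk_comp, homMk_eq_iff hW hWH]; exact factorRel_op_iff.1 ht⟩

lemma nonempty_iso_iff {X Y : SubcategoryQuotient H W} :
    Nonempty (X ≅ Y) ↔ IsoMod W X.as.obj Y.as.obj := by
  constructor
  · rintro ⟨e⟩
    obtain ⟨f, hf⟩ := homMk_surjective e.hom
    obtain ⟨g, hg⟩ := homMk_surjective e.inv
    refine ⟨f, g, ?_, ?_⟩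
    · rw [← homMk_eq_iff hW hWH (X := X) (Y := X), ← homMk_comp (Y := Y), hf, hg,
        e.hom_inv_id, homMk_id]
    · rw [← homMk_eq_iff hW hWH (X := Y) (Y := Y), ← homMk_comp (Y := X), hf, hg,
        e.inv_hom_id, homMk_id]
  · rintro ⟨f, g, hfg, hgf⟩
    refine ⟨⟨homMk f, homMk g, ?_, ?_⟩⟩
    · rwa [homMk_comp, ← homMk_id, homMk_eq_iff hW hWH]
    · rwa [homMk_comp, ← homMk_id, homMk_eq_iff hW hWH]

lemma nonempty_normalEpi_iff {B X : SubcategoryQuotient H W} {δ : B.as.obj ⟶ X.as.obj} :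
    Nonempty (NormalEpi (homMk δ : B ⟶ X)) ↔
      ∃ (A : C) (φ : A ⟶ B.as.obj), H A ∧ CokernelMod H W φ δ := by
  constructor
  · rintro ⟨A, φ, w, hc⟩
    obtain ⟨φ, rfl⟩ := homMk_surjective φ
    refine ⟨A.as.obj, φ, A.as.property, ?_,
      (epi_homMk_iff hW hWH (X := B) (Y := X)).1 (epi_of_isColimit_cofork hc),
      fun Z hZ t ht => ?_⟩
    · rwa [homMk_comp, homMk_eq_zero_iff hW hWH] at w
    · obtain ⟨Z, rfl⟩ := exists_obj_eq W hZ
      obtain ⟨u, hu⟩ := CokernelCofork.IsColimit.desc' hc (homMk t : B ⟶ Z)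
        (by rwa [homMk_comp, homMk_eq_zero_iff hW hWH])
      obtain ⟨u, rfl⟩ := homMk_surjective u
      exact ⟨u, (homMk_eq_iff hW hWH).1 hu⟩
  · rintro ⟨A, φ, hA, h0, he, h⟩
    obtain ⟨A, rfl⟩ := exists_obj_eq W hA
    have w : (homMk φ : A ⟶ B) ≫ (homMk δ : B ⟶ X) = 0 := by
      rwa [homMk_comp, homMk_eq_zero_iff hW hWH]
    have := (epi_homMk_iff hW hWH (X := B) (Y := X)).2 he
    refine ⟨⟨A, homMk φ, w, CokernelCofork.IsColimit.ofπ' _ _ fun {Z} t ht => ?_⟩⟩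
    have ex : ∃ u : X ⟶ Z, (homMk δ : B ⟶ X) ≫ u = t := by
      obtain ⟨t, rfl⟩ := homMk_surjective t
      rw [homMk_comp, homMk_eq_zero_iff hW hWH] at ht
      obtain ⟨u, hu⟩ := h Z.as.property t ht
      exact ⟨homMk u, by rwa [homMk_comp, homMk_eq_iff hW hWH]⟩
    exact ⟨ex.choose, ex.choose_spec⟩

lemma nonempty_normalMono_iff {B X : SubcategoryQuotient H W} {δ : X.as.obj ⟶ B.as.obj} :
    Nonempty (NormalMono (homMk δ : X ⟶ B)) ↔
      ∃ (A : Cᵒᵖ) (φ : A ⟶ Opposite.op B.as.obj), H.op A ∧ CokernelMod H.op W.op φ δ.op := by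
  constructor
  · rintro ⟨A, φ, w, hc⟩
    obtain ⟨φ, rfl⟩ := homMk_surjective φ
    refine ⟨Opposite.op A.as.obj, φ.op, A.as.property, ?_,
      (mono_homMk_iff hW hWH (X := X) (Y := B)).1 (mono_of_isLimit_fork hc),
      fun Z hZ t ht => ?_⟩
    · rw [homMk_comp, homMk_eq_zero_iff hW hWH] at w
      exact factorRel_op_iff.2 w
    · obtain ⟨Z, rfl⟩ := exists_op_obj_eq W hZ
      obtain ⟨t, rfl⟩ := exists_hom_op_eq t
      obtain ⟨u, hu⟩ := KernelFork.IsLimit.lift' hc (homMk t : Z ⟶ B)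
        (by rw [homMk_comp, homMk_eq_zero_iff hW hWH]; exact factorRel_op_iff.1 ht)
      obtain ⟨u, rfl⟩ := homMk_surjective u
      exact ⟨u.op, factorRel_op_iff.2 ((homMk_eq_iff hW hWH).1 hu)⟩
  · rintro ⟨A, φ, hA, h0, he, h⟩
    obtain ⟨A, rfl⟩ := exists_op_obj_eq W hA
    obtain ⟨φ, rfl⟩ := exists_hom_op_eq φ
    have w : (homMk δ : X ⟶ B) ≫ (homMk φ : B ⟶ A) = 0 := by
      rw [homMk_comp, homMk_eq_zero_iff hW hWH]
      exact factorRel_op_iff.1 h0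
    have := (mono_homMk_iff hW hWH (X := X) (Y := B)).2 he
    refine ⟨⟨A, homMk φ, w, KernelFork.IsLimit.ofι' _ _ fun {Z} t ht => ?_⟩⟩
    have ex : ∃ u : Z ⟶ X, u ≫ (homMk δ : X ⟶ B) = t := by
      obtain ⟨t, rfl⟩ := homMk_surjective t
      rw [homMk_comp, homMk_eq_zero_iff hW hWH] at ht
      obtain ⟨u, hu⟩ := h (Z := Opposite.op Z.as.obj) Z.as.property t.op (factorRel_op_iff.2 ht)
      obtain ⟨u, rfl⟩ := exists_hom_op_eq u
      exact ⟨homMk u, by rw [homMk_comp, homMk_eq_iff hW hWH]; exact factorRel_op_iff.1 hu⟩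
    exact ⟨ex.choose, ex.choose_spec⟩

lemma hasEnoughProjectivesByCokernels_iff :
    HasEnoughProjectivesByCokernels (SubcategoryQuotient H W) ↔ EnoughProjMod H W := by
  constructor
  · intro h X hX
    obtain ⟨X, rfl⟩ := exists_obj_eq W hX
    obtain ⟨P, δ, hP, hδ⟩ := h X
    obtain ⟨δ, rfl⟩ := homMk_surjective δ
    obtain ⟨A, φ, hA, hc⟩ := (nonempty_normalEpi_iff hW hWH).1 hδ
    exact ⟨A, P.as.obj, φ, δ, hA, P.as.property, (projective_iff hW hWH).1 hP, hc⟩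
  · intro h X
    obtain ⟨A, P, φ, δ, hA, hP, hPP, hc⟩ := h X.as.obj X.as.property
    obtain ⟨P, rfl⟩ := exists_obj_eq W hP
    exact ⟨P, homMk δ, (projective_iff hW hWH).2 hPP,
      (nonempty_normalEpi_iff hW hWH).2 ⟨A, φ, hA, hc⟩⟩

lemma hasEnoughInjectivesByKernels_iff :
    HasEnoughInjectivesByKernels (SubcategoryQuotient H W) ↔ EnoughProjMod H.op W.op := by
  constructor
  · intro h X hX
    obtain ⟨X, rfl⟩ := exists_op_obj_eq W hX
    obtain ⟨P, δ, hP, hδ⟩ := h X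
    obtain ⟨δ, rfl⟩ := homMk_surjective δ
    obtain ⟨A, φ, hA, hc⟩ := (nonempty_normalMono_iff hW hWH).1 hδ
    exact ⟨A, Opposite.op P.as.obj, φ, δ.op, hA, P.as.property, (injective_iff hW hWH).1 hP, hc⟩
  · intro h X
    obtain ⟨A, P, φ, δ, hA, hP, hPP, hc⟩ := h (Opposite.op X.as.obj) X.as.property
    obtain ⟨P, rfl⟩ := exists_op_obj_eq W hP
    obtain ⟨δ, rfl⟩ := exists_hom_op_eq δ
    exact ⟨P, homMk δ, (injective_iff hW hWH).2 hPP,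
      (nonempty_normalMono_iff hW hWH).2 ⟨A, φ, hA, hc⟩⟩

end SubcategoryQuotient

end SubcategoryQuotient

attribute [local instance] hasFiniteBiproducts_opposite

/-! ### Twin pairs and the final assembly -/

namespace ExactStructure

variable {C : Type*} [Category* C] [Preadditive C] [HasFiniteBiproducts C] {E : ExactStructure C}
  {S T U V : ObjectProperty C}

lemma inf_isAdditiveSummandClosed (hT : IsAdditiveSummandClosed T)
    (hU : IsAdditiveSummandClosed U) : IsAdditiveSummandClosed (T ⊓ U) where
  zero := by
    obtain ⟨Z, hZ, hTZ⟩ := hT.zero.exists_zero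
    exact ⟨Z, hZ, hTZ, hU.of_isZero hZ⟩
  sum X Y hX hY := ⟨hT.sum X Y hX.1 hY.1, hU.sum X Y hX.2 hY.2⟩
  summand X Y Z e hZ := ⟨hT.summand X Y Z e hZ.1, hU.summand X Y Z e hZ.2⟩

lemma inf_le_heartObj (hST : E.IsTwinCotorsionPair S T U V) : T ⊓ U ≤ E.heartObj S T U V := by
  intro X hX
  obtain ⟨Z, hZ, hSZ⟩ := hST.fst.left.zero.exists_zero
  exact ⟨⟨Z, X, 0, 𝟙 X, hST.snd.right.of_isZero hZ, hX, E.isConflation_zero_id X hZ⟩,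
    ⟨X, Z, 𝟙 X, 0, hX, hSZ, E.isConflation_id_zero X hZ⟩⟩

/-- The inclusion `S ≤ U` makes the `(S, T)`-coresolution of an object of `V` split. This is the
inclusion needed for the opposite pairs to be twin. -/
lemma IsTwinCotorsionPair.right_le (hST : E.IsTwinCotorsionPair S T U V) : V ≤ T := by
  intro X hX
  obtain ⟨T', S', i, d, hT', hS', hid⟩ := hST.fst.coresolution X
  obtain ⟨e⟩ := hid.nonempty_iso (hST.snd.ext_vanishes _ _ (hST.le _ hS') hX)
  exact hST.fst.right.summand _ _ _ ⟨e⟩ hT'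

end ExactStructure

open SubcategoryQuotient ExactStructure in
theorem proposition8 {C : Type*} [Category* C] [Preadditive C] [HasFiniteBiproducts C]
    (E : ExactStructure C) (hKS : IsKrullSchmidt C)
    (hproj : E.HasEnoughProj) (hinj : E.HasEnoughInj)
    (S T U V : ObjectProperty C) (hST : E.IsTwinCotorsionPair S T U V) :
    (U ≤ T →
      E.syzygy S ≤ E.heartObj S T U V ∧
      (∀ X : E.Heart S T U V, Projective X ↔
        ∃ Y : E.Heart S T U V, E.syzygy S Y.as.obj ∧ Nonempty (X ≅ Y)) ∧
      (HasEnoughProjectivesByCokernels (E.Heart S T U V) ↔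
        ∀ B : C, Indecomposable B → E.heartObj S T U V B → ¬ U B →
          ∃ (S₁ S₂ : C) (i : B ⟶ S₁) (d : S₁ ⟶ S₂), S S₁ ∧ S S₂ ∧ E.IsConflation i d)) ∧
    (T ≤ U →
      E.cosyzygy V ≤ E.heartObj S T U V ∧
      (∀ X : E.Heart S T U V, Injective X ↔
        ∃ Y : E.Heart S T U V, E.cosyzygy V Y.as.obj ∧ Nonempty (X ≅ Y)) ∧
      (HasEnoughInjectivesByKernels (E.Heart S T U V) ↔
        ∀ B : C, Indecomposable B → E.heartObj S T U V B → ¬ T B →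
          ∃ (V₂ V₁ : C) (i : V₂ ⟶ V₁) (d : V₁ ⟶ B), V V₁ ∧ V V₂ ∧ E.IsConflation i d)) := by
  have hL := hKS.isSumOfLocals
  have hW := inf_isAdditiveSummandClosed hST.fst.right hST.snd.left
  have hWH := inf_le_heartObj hST
  have hind : ∀ B : C, Indecomposable B ↔ IsLocalObject B := fun B =>
    ⟨(hL B).isLocalObject, IsLocalObject.indecomposable⟩
  refine ⟨fun hUT => ?_, fun hTU => ?_⟩
  · have hH := heartObj_eq_embedsInto (S := S) hST.snd hUT
    have hTU : T ⊓ U = U := inf_eq_right.2 hUT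
    have hΩ : E.syzygy S ≤ E.heartObj S T U V := hH ▸ syzygy_le_embedsInto hST.snd
    refine ⟨hΩ, fun X => ?_, ?_⟩
    · have key : ∀ Z, E.heartObj S T U V Z → (ProjMod (E.heartObj S T U V) (T ⊓ U) Z ↔
          ∃ Y, E.syzygy S Y ∧ IsoMod (T ⊓ U) Z Y) := by
        intro Z hZ
        rw [hH] at hZ
        rw [hTU, hH, projMod_iff hST.fst hST.snd hST.le hUT hproj hL hZ]
      refine ((projective_iff hW hWH).trans (key _ X.as.property)).trans ⟨?_, ?_⟩
      · rintro ⟨Y, hY, e⟩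
        exact ⟨⟨⟨Y, hΩ _ hY⟩⟩, hY, (nonempty_iso_iff hW hWH).2 e⟩
      · rintro ⟨Y, hY, e⟩
        exact ⟨Y.as.obj, hY, (nonempty_iso_iff hW hWH).1 e⟩
    · rw [hasEnoughProjectivesByCokernels_iff hW hWH, hTU, hH,
        enoughProjMod_iff hST.fst hST.snd hST.le hUT hproj hL]
      simp only [hind]
      rfl
  · have hH := heartObj_op_eq_embedsInto (U := U) (V := V) hST.fst hTU
    have hVT : V ≤ T := hST.right_le
    -- In the opposite category `(V, U)` and `(T, S)` take the places of `(S, T)` and `(U, V)`, and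
    -- `T ≤ U` becomes the standing inclusion.
    have hfst := hST.snd.op
    have hsnd := hST.fst.op
    have hVT' : V.op ≤ T.op := fun X => hVT X.unop
    have hTU' : T.op ≤ U.op := fun X => hTU X.unop
    have hLop : ∀ X : Cᵒᵖ, IsSumOfLocals X := fun X => (hL X.unop).op
    have hTU'' : T ⊓ U = T := inf_eq_left.2 hTU
    have hΩ : E.cosyzygy V ≤ E.heartObj S T U V := fun X hX => by
      have := syzygy_le_embedsInto hsnd (S := V.op) (Opposite.op X) (syzygy_op_iff.2 hX)
      rw [← hH] at this
      exact this
    refine ⟨hΩ, fun X => ?_, ?_⟩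
    · have key : ∀ Z, (E.heartObj S T U V).op Z →
          (ProjMod (E.heartObj S T U V).op (T ⊓ U).op Z ↔
            ∃ Y, E.op.syzygy V.op Y ∧ IsoMod (T ⊓ U).op Z Y) := by
        intro Z hZ
        rw [hH] at hZ
        rw [hTU'', hH, projMod_iff hfst hsnd hVT' hTU' hinj.op hLop hZ]
      refine ((injective_iff hW hWH).trans
        (key (Opposite.op X.as.obj) X.as.property)).trans ⟨?_, ?_⟩
      · rintro ⟨Y, hY, e⟩
        rw [syzygy_op_iff] at hY
        exact ⟨⟨⟨Y.unop, hΩ _ hY⟩⟩, hY, (nonempty_iso_iff hW hWH).2 (isoMod_op_iff.1 e)⟩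
      · rintro ⟨Y, hY, e⟩
        exact ⟨Opposite.op Y.as.obj, syzygy_op_iff.2 hY,
          isoMod_op_iff.2 ((nonempty_iso_iff hW hWH).1 e)⟩
    · rw [hasEnoughInjectivesByKernels_iff hW hWH, hTU'', hH,
        enoughProjMod_iff hfst hsnd hVT' hTU' hinj.op hLop, ← hH]
      constructor
      · intro h B hB hBH hBT
        obtain ⟨V₂, V₁, i, d, h₂, h₁, h⟩ := embedsInto_op_iff.1
          (h (Opposite.op B) (isLocalObject_op_iff.2 ((hind B).1 hB)) hBH hBT)
        exact ⟨V₂, V₁, i, d, h₁, h₂, h⟩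
      · intro h B hB hBH hBT
        obtain ⟨V₂, V₁, i, d, h₁, h₂, h⟩ :=
          h B.unop ((hind _).2 (isLocalObject_op_iff.1 hB)) hBH hBT
        exact embedsInto_op_iff.2 ⟨V₂, V₁, i, d, h₂, h₁, h⟩
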